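/- Let $n>1$ and let $M$ be a smooth manifold of dimension $2n+1$ (so $\dim M>3$) with an almost contact pseudo-metric structure $(\varphi,\xi,\eta,g)$: $\varphi$ is a smooth $(1,1)$-tensor field, $\xi$ a smooth vector field, $\eta$ a smooth 1-form and $g$ a pseudo-Riemannian metric on $M$ with $$\varphi^2=-I+\eta\otimes\xi,\quad \eta(\xi)=1,\quad \varphi\xi=0,\quad \eta\circ\varphi=0,\quad g(\varphi X,\varphi Y)=g(X,Y)-\varepsilon\,\eta(X)\eta(Y),$$ where $\varepsilon\in\{1,-1\}$. Let $\nabla$ be the Levi-Civita connection of $g$, let $R(X,Y)=[\nabla_X,\nabla_Y]-\nabla_{[X,Y]}$, and let $\mathrm{Ric}(Y,Z)=\mathrm{tr}\,(X\mapsto R(X,Y)Z)$ be the Ricci tensor. Assume that $M$ is a Kenmotsu pseudo-metric manifold, that is, $$(\nabla_X\varphi)Y=-\eta(Y)\varphi X-\varepsilon\, g(X,\varphi Y)\xi\quad\text{for all vector fields } X,Y,$$ and that it is $\eta$-Einstein, that is, $\mathrm{Ric}=a\,g+b\,\eta\otimes\eta$ for some smooth functions $a,b$ on $M$. If $(g,V)$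 is a Ricci soliton, i.e. $V$ is a smooth vector field and there is a constant $\lambda\in\mathbb{R}$ with $$(\pounds_V g)(X,Y)+2\,\mathrm{Ric}(X,Y)+2\lambda\, g(X,Y)=0\quad\text{for all vector fields } X,Y,$$ then $M$ is Einstein (i.e. $\mathrm{Ric}=c\,g$ for a constant $c$), and in fact $\mathrm{Ric}=-2n\varepsilon\, g$. -/

import Mathlib

open Bundle Manifold
open scoped ContDiff Topology

noncomputable section

/-! ### Pseudo-Riemannian metrics -/

section PseudoRiemannian

variable (E : Type*) [NormedAddCommGroup E] [NormedSpace ℝ E]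
  (M : Type*) [TopologicalSpace M] [ChartedSpace E M] [IsManifold 𝓘(ℝ, E) ∞ M]

/-- A (smooth) pseudo-Riemannian metric on the manifold `M` modelled on `E`: a smooth family of
symmetric nondegenerate bilinear forms on the tangent spaces. No signature is prescribed. -/
structure PseudoRiemannianMetric where
  /-- The scalar product on the tangent spaces. -/
  inner (x : M) : TangentSpace 𝓘(ℝ, E) x →L[ℝ] TangentSpace 𝓘(ℝ, E) x →L[ℝ] ℝ
  symm (x : M) (u v : TangentSpace 𝓘(ℝ, E) x) : inner x u v = inner x v u
  nondegenerate (x : M) (u : TangentSpace 𝓘(ℝ, E) x) (hu : ∀ v, inner x u v = 0) : u = 0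
  contMDiff : ContMDiff 𝓘(ℝ, E) (𝓘(ℝ, E).prod 𝓘(ℝ, E →L[ℝ] E →L[ℝ] ℝ)) ∞
    (fun x ↦ TotalSpace.mk' (E →L[ℝ] E →L[ℝ] ℝ) x (inner x))

end PseudoRiemannian

namespace PseudoRiemannianMetric

variable {E : Type*} [NormedAddCommGroup E] [NormedSpace ℝ E]
  {M : Type*} [TopologicalSpace M] [ChartedSpace E M] [IsManifold 𝓘(ℝ, E) ∞ M]
  (g : PseudoRiemannianMetric E M)

/-- The function `g(X, Y)` for two vector fields `X`, `Y`. -/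
def pair (X Y : Π x : M, TangentSpace 𝓘(ℝ, E) x) (x : M) : ℝ :=
  g.inner x (X x) (Y x)

/-- The right-hand side of the Koszul formula,
`X g(Y,Z) + Y g(Z,X) - Z g(X,Y) + g([X,Y],Z) - g([Y,Z],X) + g([Z,X],Y)`. -/
def koszul (X Y Z : Π x : M, TangentSpace 𝓘(ℝ, E) x) (x : M) : ℝ :=
  mvfderiv 𝓘(ℝ, E) (g.pair Y Z) x (X x) + mvfderiv 𝓘(ℝ, E) (g.pair Z X) x (Y x)
    - mvfderiv 𝓘(ℝ, E) (g.pair X Y) x (Z x)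
    + g.inner x (VectorField.mlieBracket 𝓘(ℝ, E) X Y x) (Z x)
    - g.inner x (VectorField.mlieBracket 𝓘(ℝ, E) Y Z x) (X x)
    + g.inner x (VectorField.mlieBracket 𝓘(ℝ, E) Z X x) (Y x)

variable {g} {X Y Z X' Y' Z' : Π x : M, TangentSpace 𝓘(ℝ, E) x} {f : M → ℝ} {x : M}

lemma pair_comm (X Y : Π x : M, TangentSpace 𝓘(ℝ, E) x) : g.pair X Y = g.pair Y X := by
  ext y; exact g.symm y _ _

lemma mdifferentiableAt_pair (hX : MDiffAt (T% X) x) (hY : MDiffAt (T% Y) x) :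
    MDiffAt (g.pair X Y) x := by
  have hg : MDiffAt (fun y ↦ TotalSpace.mk' (E →L[ℝ] E →L[ℝ] ℝ)
      (E := fun y : M ↦ (TangentSpace 𝓘(ℝ, E) y →L[ℝ] TangentSpace 𝓘(ℝ, E) y →L[ℝ] ℝ))
      y (g.inner y)) x := (g.contMDiff x).mdifferentiableAt (by simp)
  have h := MDifferentiableAt.clm_bundle_apply₂ (F₁ := E) (F₂ := E) (F₃ := ℝ)
    (E₁ := fun y : M ↦ TangentSpace 𝓘(ℝ, E) y) (E₂ := fun y : M ↦ TangentSpace 𝓘(ℝ, E) y)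
    (E₃ := Bundle.Trivial M ℝ) hg hX hY
  rw [mdifferentiableAt_section] at h
  simpa using! h

lemma pair_add_left : g.pair (X + X') Y = g.pair X Y + g.pair X' Y := by
  ext y; simp [pair]

lemma pair_add_right : g.pair X (Y + Y') = g.pair X Y + g.pair X Y' := by
  ext y; simp [pair]

lemma pair_smul_left : g.pair (f • X) Y = f * g.pair X Y := by
  ext y; simp [pair]

lemma pair_smul_right : g.pair X (f • Y) = f * g.pair X Y := by
  ext y; simp [pair]

variable [FiniteDimensional ℝ E]

lemma koszul_add_left (hX : MDiffAt (T% X) x) (hX' : MDiffAt (T% X') x)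
    (hY : MDiffAt (T% Y) x) (hZ : MDiffAt (T% Z) x) :
    g.koszul (X + X') Y Z x = g.koszul X Y Z x + g.koszul X' Y Z x := by
  have : CompleteSpace E := FiniteDimensional.complete ℝ E
  simp only [koszul, pair_add_left, pair_add_right,
    mvfderiv_add (mdifferentiableAt_pair hX hY) (mdifferentiableAt_pair hX' hY),
    mvfderiv_add (mdifferentiableAt_pair hZ hX) (mdifferentiableAt_pair hZ hX'),
    VectorField.mlieBracket_add_left hX hX', VectorField.mlieBracket_add_right hX hX']
  simp
  ring

lemma koszul_smul_left (hf : MDiffAt f x) (hX : MDiffAt (T% X) x)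
    (hY : MDiffAt (T% Y) x) (hZ : MDiffAt (T% Z) x) :
    g.koszul (f • X) Y Z x = f x * g.koszul X Y Z x := by
  have : CompleteSpace E := FiniteDimensional.complete ℝ E
  simp only [koszul, pair_smul_left, pair_smul_right,
    mvfderiv_mul hf (mdifferentiableAt_pair hX hY),
    mvfderiv_mul hf (mdifferentiableAt_pair hZ hX),
    VectorField.mlieBracket_smul_left hf hX, VectorField.mlieBracket_smul_right hf hX]
  simp [pair, g.symm x (Z x) (X x)]
  ring

lemma koszul_add_right (hX : MDiffAt (T% X) x)
    (hY : MDiffAt (T% Y) x) (hZ : MDiffAt (T% Z) x) (hZ' : MDiffAt (T% Z') x) :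
    g.koszul X Y (Z + Z') x = g.koszul X Y Z x + g.koszul X Y Z' x := by
  have : CompleteSpace E := FiniteDimensional.complete ℝ E
  simp only [koszul, pair_add_left, pair_add_right,
    mvfderiv_add (mdifferentiableAt_pair hY hZ) (mdifferentiableAt_pair hY hZ'),
    mvfderiv_add (mdifferentiableAt_pair hZ hX) (mdifferentiableAt_pair hZ' hX),
    VectorField.mlieBracket_add_left hZ hZ', VectorField.mlieBracket_add_right hZ hZ']
  simp
  ring

lemma koszul_smul_right (hf : MDiffAt f x) (hX : MDiffAt (T% X) x)
    (hY : MDiffAt (T% Y) x) (hZ : MDiffAt (T% Z) x) :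
    g.koszul X Y (f • Z) x = f x * g.koszul X Y Z x := by
  have : CompleteSpace E := FiniteDimensional.complete ℝ E
  simp only [koszul, pair_smul_left, pair_smul_right,
    mvfderiv_mul hf (mdifferentiableAt_pair hY hZ),
    mvfderiv_mul hf (mdifferentiableAt_pair hZ hX),
    VectorField.mlieBracket_smul_left hf hZ, VectorField.mlieBracket_smul_right hf hZ]
  simp [pair, g.symm x (Y x) (Z x)]
  ring

lemma koszul_add_middle (hX : MDiffAt (T% X) x)
    (hY : MDiffAt (T% Y) x) (hY' : MDiffAt (T% Y') x) (hZ : MDiffAt (T% Z) x) :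
    g.koszul X (Y + Y') Z x = g.koszul X Y Z x + g.koszul X Y' Z x := by
  have : CompleteSpace E := FiniteDimensional.complete ℝ E
  simp only [koszul, pair_add_left, pair_add_right,
    mvfderiv_add (mdifferentiableAt_pair hY hZ) (mdifferentiableAt_pair hY' hZ),
    mvfderiv_add (mdifferentiableAt_pair hX hY) (mdifferentiableAt_pair hX hY'),
    VectorField.mlieBracket_add_left hY hY', VectorField.mlieBracket_add_right hY hY']
  simp
  ring

lemma koszul_smul_middle (hf : MDiffAt f x) (hX : MDiffAt (T% X) x)
    (hY : MDiffAt (T% Y) x) (hZ : MDiffAt (T% Z) x) :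
    g.koszul X (f • Y) Z x = f x * g.koszul X Y Z x
      + 2 * (mvfderiv 𝓘(ℝ, E) f x (X x) * g.inner x (Y x) (Z x)) := by
  have : CompleteSpace E := FiniteDimensional.complete ℝ E
  simp only [koszul, pair_smul_left, pair_smul_right,
    mvfderiv_mul hf (mdifferentiableAt_pair hY hZ),
    mvfderiv_mul hf (mdifferentiableAt_pair hX hY),
    VectorField.mlieBracket_smul_left hf hY, VectorField.mlieBracket_smul_right hf hY]
  simp [pair, g.symm x (Y x) (X x)]
  ring

variable (g) in
/-- For a vector field `Y` differentiable at `x`, the Koszul expression as a bilinear form in the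
values of `X` and `Z` at `x`. -/
def koszulForm (hY : MDiffAt (T% Y) x) :
    TangentSpace 𝓘(ℝ, E) x →L[ℝ] TangentSpace 𝓘(ℝ, E) x →L[ℝ] ℝ :=
  TensorialAt.mkHom₂ (I := 𝓘(ℝ, E)) (F := E) (F' := E) (fun X Z ↦ g.koszul X Y Z x) x
    (fun _ hZ ↦ ⟨fun hf hX ↦ koszul_smul_left hf hX hY hZ,
      fun hX hX' ↦ koszul_add_left hX hX' hY hZ⟩)
    (fun _ hX ↦ ⟨fun hf hZ ↦ koszul_smul_right hf hX hY hZ,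
      fun hZ hZ' ↦ koszul_add_right hX hY hZ hZ'⟩)

lemma koszulForm_apply (hX : MDiffAt (T% X) x) (hY : MDiffAt (T% Y) x) (hZ : MDiffAt (T% Z) x) :
    g.koszulForm hY (X x) (Z x) = g.koszul X Y Z x :=
  TensorialAt.mkHom₂_apply _ _ hX hZ

variable (g) in
/-- The musical isomorphism `u ↦ g(u, ·)` from the tangent to the cotangent space. -/
def flat (x : M) :
    TangentSpace 𝓘(ℝ, E) x ≃ₗ[ℝ] (TangentSpace 𝓘(ℝ, E) x →L[ℝ] ℝ) :=
  haveI : FiniteDimensional ℝ (TangentSpace 𝓘(ℝ, E) x) := inferInstanceAs (FiniteDimensional ℝ E)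
  haveI : T2Space (TangentSpace 𝓘(ℝ, E) x) := inferInstanceAs (T2Space E)
  LinearEquiv.ofInjectiveOfFinrankEq (g.inner x).toLinearMap
    (by
      rw [← LinearMap.ker_eq_bot, LinearMap.ker_eq_bot']
      intro u hu
      exact g.nondegenerate x u fun v ↦ by simpa using congr($hu v))
    (by
      have h : (Module.Dual ℝ (TangentSpace 𝓘(ℝ, E) x)) ≃ₗ[ℝ] (TangentSpace 𝓘(ℝ, E) x →L[ℝ] ℝ) :=
        LinearMap.toContinuousLinearMap
      rw [← h.finrank_eq]
      exact Subspace.dual_finrank_eq.symm)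

lemma flat_apply (u v : TangentSpace 𝓘(ℝ, E) x) : g.flat x u v = g.inner x u v := rfl

lemma inner_flat_symm (a : TangentSpace 𝓘(ℝ, E) x →L[ℝ] ℝ) (v : TangentSpace 𝓘(ℝ, E) x) :
    g.inner x ((g.flat x).symm a) v = a v := by
  rw [← flat_apply, LinearEquiv.apply_symm_apply]

lemma ext_inner {u v : TangentSpace 𝓘(ℝ, E) x} (h : ∀ w, g.inner x u w = g.inner x v w) :
    u = v :=
  (g.flat x).injective (by ext w; exact h w)

open scoped Classical in
variable (g) in
/-- The Levi-Civita derivative: for `Y` differentiable at `x`, the derivative `∇_u Y` is the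
vector with `2 g(∇_u Y, w) = K(u, Y, w)`, where `K` is the Koszul expression. (At points where `Y`
is not differentiable the value is irrelevant; it is set to zero.) -/
def leviCivitaFun (Y : Π x : M, TangentSpace 𝓘(ℝ, E) x) (x : M) :
    TangentSpace 𝓘(ℝ, E) x →L[ℝ] TangentSpace 𝓘(ℝ, E) x :=
  haveI : FiniteDimensional ℝ (TangentSpace 𝓘(ℝ, E) x) := inferInstanceAs (FiniteDimensional ℝ E)
  haveI : T2Space (TangentSpace 𝓘(ℝ, E) x) := inferInstanceAs (T2Space E)
  if hY : MDiffAt (T% Y) x then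
    LinearMap.toContinuousLinearMap
      ((g.flat x).symm.toLinearMap ∘ₗ ((1 / 2 : ℝ) • g.koszulForm hY).toLinearMap)
  else 0

lemma inner_leviCivitaFun (hX : MDiffAt (T% X) x) (hY : MDiffAt (T% Y) x)
    (hZ : MDiffAt (T% Z) x) :
    g.inner x (g.leviCivitaFun Y x (X x)) (Z x) = 1 / 2 * g.koszul X Y Z x := by
  rw [← koszulForm_apply hX hY hZ]
  simp [leviCivitaFun, hY, inner_flat_symm]

variable (g) in
/-- The Levi-Civita connection of a pseudo-Riemannian metric, given by the Koszul formula.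
As in Mathlib, `g.leviCivita Y x (X x)` is `∇_X Y` at `x`. -/
def leviCivita : CovariantDerivative 𝓘(ℝ, E) E (TangentSpace 𝓘(ℝ, E) : M → Type _) where
  toFun := g.leviCivitaFun
  isCovariantDerivativeOnUniv :=
    { add := by
        intro Y Y' x hY hY' _
        ext u
        refine ext_inner (g := g) fun w ↦ ?_
        have hu := FiberBundle.mdifferentiableAt_extend 𝓘(ℝ, E) E u
        have hw := FiberBundle.mdifferentiableAt_extend 𝓘(ℝ, E) E w
        have h1 := inner_leviCivitaFun (g := g) hu (mdifferentiableAt_add_section hY hY') hw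
        have h2 := inner_leviCivitaFun (g := g) hu hY hw
        have h3 := inner_leviCivitaFun (g := g) hu hY' hw
        rw [koszul_add_middle hu hY hY' hw] at h1
        simp only [FiberBundle.extend_apply_self] at h1 h2 h3
        simp only [add_apply, map_add, h1, h2, h3]
        ring
      leibniz := by
        intro Y f x hY hf _
        ext u
        refine ext_inner (g := g) fun w ↦ ?_
        have hu := FiberBundle.mdifferentiableAt_extend 𝓘(ℝ, E) E u
        have hw := FiberBundle.mdifferentiableAt_extend 𝓘(ℝ, E) E w
        have h1 := inner_leviCivitaFun (g := g) hu (hf.smul_section hY) hw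
        have h2 := inner_leviCivitaFun (g := g) hu hY hw
        rw [koszul_smul_middle hf hu hY hw] at h1
        simp only [FiberBundle.extend_apply_self] at h1 h2
        simp [h1, h2]
        ring }

/-- The Levi-Civita connection is torsion-free. -/
lemma leviCivita_torsion (hX : MDiffAt (T% X) x) (hY : MDiffAt (T% Y) x) :
    g.leviCivita Y x (X x) - g.leviCivita X x (Y x) = VectorField.mlieBracket 𝓘(ℝ, E) X Y x := by
  refine ext_inner (g := g) fun w ↦ ?_
  have hw := FiberBundle.mdifferentiableAt_extend 𝓘(ℝ, E) E w
  have h1 := inner_leviCivitaFun (g := g) hX hY hw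
  have h2 := inner_leviCivitaFun (g := g) hY hX hw
  simp only [FiberBundle.extend_apply_self] at h1 h2
  change g.inner x (g.leviCivitaFun Y x (X x) - g.leviCivitaFun X x (Y x)) w = _
  rw [map_sub, sub_apply, h1, h2]
  set W := FiberBundle.extend E w
  simp only [koszul, pair_comm Y W, pair_comm X W, pair_comm Y X,
    VectorField.mlieBracket_swap_apply (V := Y) (W := X),
    VectorField.mlieBracket_swap_apply (V := Y) (W := W),
    VectorField.mlieBracket_swap_apply (V := X) (W := W)]
  simp [W]
  ring

/-- The Levi-Civita connection is compatible with the metric. -/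
lemma leviCivita_metric (hX : MDiffAt (T% X) x) (hY : MDiffAt (T% Y) x)
    (u : TangentSpace 𝓘(ℝ, E) x) :
    mvfderiv 𝓘(ℝ, E) (g.pair X Y) x u =
      g.inner x (g.leviCivita X x u) (Y x) + g.inner x (X x) (g.leviCivita Y x u) := by
  have hu := FiberBundle.mdifferentiableAt_extend 𝓘(ℝ, E) E u
  have h1 := inner_leviCivitaFun (g := g) hu hX hY
  have h2 := inner_leviCivitaFun (g := g) hu hY hX
  simp only [FiberBundle.extend_apply_self] at h1 h2
  change _ = g.inner x (g.leviCivitaFun X x u) (Y x) + g.inner x (X x) (g.leviCivitaFun Y x u)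
  rw [g.symm x (X x), h1, h2]
  set U := FiberBundle.extend E u
  simp only [koszul, pair_comm X U, pair_comm Y U, pair_comm Y X,
    VectorField.mlieBracket_swap_apply (V := Y) (W := X),
    VectorField.mlieBracket_swap_apply (V := Y) (W := U),
    VectorField.mlieBracket_swap_apply (V := X) (W := U)]
  simp [U]
  ring

variable (g)

/-- The vector field `∇_X Y`. -/
def nabla (X Y : Π x : M, TangentSpace 𝓘(ℝ, E) x) : Π x : M, TangentSpace 𝓘(ℝ, E) x :=
  fun x ↦ g.leviCivita Y x (X x)

/-- The Riemann curvature `R(X,Y)Z = ∇_X ∇_Y Z - ∇_Y ∇_X Z - ∇_[X,Y] Z`. -/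
def curvature (X Y Z : Π x : M, TangentSpace 𝓘(ℝ, E) x) : Π x : M, TangentSpace 𝓘(ℝ, E) x :=
  g.nabla X (g.nabla Y Z) - g.nabla Y (g.nabla X Z)
    - g.nabla (VectorField.mlieBracket 𝓘(ℝ, E) X Y) Z

/-- The Ricci tensor `Ric(v, w)`, the trace of `u ↦ R(u, v)w`. The trace is written as the sum of
the diagonal matrix entries in a basis, and `R` is evaluated on tangent vectors by extending them
to vector fields that are smooth near the base point. -/
def ricci (x : M) (v w : TangentSpace 𝓘(ℝ, E) x) : ℝ :=
  let b : Module.Basis (Fin (Module.finrank ℝ E)) ℝ (TangentSpace 𝓘(ℝ, E) x) :=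
    Module.finBasis ℝ E
  ∑ i, b.repr (g.curvature (FiberBundle.extend E (b i)) (FiberBundle.extend E v)
    (FiberBundle.extend E w) x) i

/-- The Lie derivative of the metric,
`(£_V g)(X, Y) = V g(X, Y) - g([V, X], Y) - g(X, [V, Y])`. -/
def lieDerivative (V X Y : Π x : M, TangentSpace 𝓘(ℝ, E) x) (x : M) : ℝ :=
  mvfderiv 𝓘(ℝ, E) (g.pair X Y) x (V x)
    - g.inner x (VectorField.mlieBracket 𝓘(ℝ, E) V X x) (Y x)
    - g.inner x (X x) (VectorField.mlieBracket 𝓘(ℝ, E) V Y x)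

/-- `(g, V)` is a Ricci soliton with soliton constant `lam`: `V` is a smooth vector field and
`(£_V g)(X, Y) + 2 Ric(X, Y) + 2 lam g(X, Y) = 0` for all vector fields `X`, `Y`. (The expression
is tensorial in `X` and `Y`, so at each point it is evaluated on all fields differentiable
there.) -/
structure IsRicciSoliton (V : Π x : M, TangentSpace 𝓘(ℝ, E) x) (lam : ℝ) : Prop where
  contMDiff : CMDiff ∞ (T% V)
  eq_zero : ∀ (x : M) (X Y : Π x : M, TangentSpace 𝓘(ℝ, E) x),
    MDiffAt (T% X) x → MDiffAt (T% Y) x →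
    g.lieDerivative V X Y x + 2 * g.ricci x (X x) (Y x) + 2 * lam * g.inner x (X x) (Y x) = 0

/-- The metric is Einstein: `Ric = c g` for a constant `c`. -/
def IsEinstein : Prop :=
  ∃ c : ℝ, ∀ (x : M) (v w : TangentSpace 𝓘(ℝ, E) x), g.ricci x v w = c * g.inner x v w

end PseudoRiemannianMetric

/-! ### Almost contact pseudo-metric structures -/

section AlmostContact

variable (E : Type*) [NormedAddCommGroup E] [NormedSpace ℝ E]
  (M : Type*) [TopologicalSpace M] [ChartedSpace E M] [IsManifold 𝓘(ℝ, E) ∞ M]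

/-- An almost contact pseudo-metric structure `(φ, ξ, η, g)` on `M`, with `ε = ±1`. -/
structure AlmostContactPseudoMetric where
  /-- The pseudo-Riemannian metric. -/
  g : PseudoRiemannianMetric E M
  /-- The tensor field of type `(1, 1)`. -/
  φ (x : M) : TangentSpace 𝓘(ℝ, E) x →L[ℝ] TangentSpace 𝓘(ℝ, E) x
  /-- The characteristic (Reeb) vector field. -/
  ξ (x : M) : TangentSpace 𝓘(ℝ, E) x
  /-- The 1-form. -/
  η (x : M) : TangentSpace 𝓘(ℝ, E) x →L[ℝ] ℝ
  /-- The sign `ε`. -/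
  ε : ℝ
  contMDiff_φ : ContMDiff 𝓘(ℝ, E) (𝓘(ℝ, E).prod 𝓘(ℝ, E →L[ℝ] E)) ∞
    (fun x ↦ TotalSpace.mk' (E →L[ℝ] E)
      (E := fun x : M ↦ TangentSpace 𝓘(ℝ, E) x →L[ℝ] TangentSpace 𝓘(ℝ, E) x) x (φ x))
  contMDiff_ξ : CMDiff ∞ (T% ξ)
  contMDiff_η : ContMDiff 𝓘(ℝ, E) (𝓘(ℝ, E).prod 𝓘(ℝ, E →L[ℝ] ℝ)) ∞
    (fun x ↦ TotalSpace.mk' (E →L[ℝ] ℝ)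
      (E := fun x : M ↦ TangentSpace 𝓘(ℝ, E) x →L[ℝ] ℝ) x (η x))
  ε_eq : ε = 1 ∨ ε = -1
  φ_φ (x : M) (u : TangentSpace 𝓘(ℝ, E) x) : φ x (φ x u) = -u + η x u • ξ x
  η_ξ (x : M) : η x (ξ x) = 1
  φ_ξ (x : M) : φ x (ξ x) = 0
  η_φ (x : M) (u : TangentSpace 𝓘(ℝ, E) x) : η x (φ x u) = 0
  inner_φ_φ (x : M) (u v : TangentSpace 𝓘(ℝ, E) x) :
    g.inner x (φ x u) (φ x v) = g.inner x u v - ε * η x u * η x v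

end AlmostContact

namespace AlmostContactPseudoMetric

variable {E : Type*} [NormedAddCommGroup E] [NormedSpace ℝ E] [FiniteDimensional ℝ E]
  {M : Type*} [TopologicalSpace M] [ChartedSpace E M] [IsManifold 𝓘(ℝ, E) ∞ M]
  (S : AlmostContactPseudoMetric E M)

/-- The Kenmotsu condition `(∇_X φ)Y = -η(Y) φX - ε g(X, φY) ξ`, where
`(∇_X φ)Y = ∇_X (φY) - φ(∇_X Y)` (an expression that is tensorial in `X` and `Y`). -/
def IsKenmotsu : Prop :=
  ∀ (x : M) (X Y : Π x : M, TangentSpace 𝓘(ℝ, E) x), MDiffAt (T% X) x → MDiffAt (T% Y) x →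
    S.g.nabla X (fun y ↦ S.φ y (Y y)) x - S.φ x (S.g.nabla X Y x) =
      -(S.η x (Y x) • S.φ x (X x)) - (S.ε * S.g.inner x (X x) (S.φ x (Y x))) • S.ξ x

/-- The structure is `η`-Einstein: `Ric = a g + b η ⊗ η` for smooth functions `a`, `b`. -/
def IsEtaEinstein : Prop :=
  ∃ a b : M → ℝ, CMDiff ∞ a ∧ CMDiff ∞ b ∧
    ∀ (x : M) (u v : TangentSpace 𝓘(ℝ, E) x),
      S.g.ricci x u v = a x * S.g.inner x u v + b x * S.η x u * S.η x v

end AlmostContactPseudoMetric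

end

/-!
Locally a Kenmotsu metric is a warped product `g = ε dt² + e^{2t} h` with `η = dt` and `h` Kähler of
real dimension `2n`. The proof works with the connection of the product `e^{-2t} g`, which has a
global description as the Weyl connection (`KenmotsuCalculus.weyl`)
`d_X Y = ∇_X Y - η(X) Y - η(Y) X + ε g(X, Y) ξ`. It satisfies `dφ = 0` and `d_X ξ = -η(X) ξ`, and
its curvature `R'` is pair symmetric, commutes with `φ`, vanishes if one argument is `ξ`, and is
parallel along `ξ` (`KenmotsuCalculus.weyl_nab_ξ_curv`). Its Ricci tensor is `Ric + 2n ε g`, so that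
`ε a + b = -2n` and `Ric' = -ε b (g - ε η ⊗ η)` for `Ric = a g + b η ⊗ η`; differentiating this
trace along `ξ` yields `ξ b = -2 b` (`AlmostContactPseudoMetric.D_ξ_coeff`).

For a soliton field `V`, let `U` be the horizontal gradient of `η(V)`. The mixed part of the soliton
equation identifies `U` with `-ε d_ξ (hor V)`, and its horizontal part, differentiated along `ξ`,
becomes `d_X U = k X` for horizontal `X`, with `k = 2 b + ε c` and a constant `c`
(`KenmotsuCalculus.IsSoliton.weyl_nab_solitonGrad`). Hence `R'(X, Y)U = 2 ((X b) Y - (Y b) X)`. As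
`R'(φX, φY) = R'(X, Y)` and the horizontal space has dimension at least four, `b` is constant in the
horizontal directions (`AlmostContactPseudoMetric.D_eq_zero_of_soliton`), so `R'(·, ·)U = 0`. Then
`Ric'(·, U) = 0`, that is `b U = 0`, whence `b k = 0`. The derivative of the last equation along `ξ`
gives `b² = 0`, and `Ric = a g` with `a = -2n ε`. This argument replaces the contracted second
Bianchi identity by the Kähler symmetry of the curvature.

All tensor calculus takes place in the module of smooth vector fields over the ring of smooth
functions, for an abstract module with a torsion-free connection. Bump functions link it to tangent
vectors: vectors extend to global smooth fields, linear maps of fields act pointwise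
(`SmoothField.evalAt`), and `PseudoRiemannianMetric.ricci_eq_trace` expresses the Ricci tensor as
the trace of such a map. The Levi-Civita derivative of smooth fields is smooth by Cramer's rule
(`PseudoRiemannianMetric.contMDiff_of_pair`).
-/

section Algebra

variable {A L : Type*} [CommRing A] [Algebra ℝ A] [AddCommGroup L] [Module A L]

/-! ### Torsion-free connections on a module of vector fields -/

variable (A L) in
/-- A torsion-free connection on an `A`-module `L`, an algebraic model for the smooth functions `A`
and the smooth vector fields `L` of a manifold. The Lie bracket is not a separate datum: vanishing
torsion forces `[X, Y] = ∇_X Y - ∇_Y X`, and the last two fields say that this expression acts on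
functions as a commutator and satisfies the Jacobi identity. -/
structure TorsionFreeConnection where
  /-- The derivative of functions along vector fields. -/
  D : L →ₗ[A] Derivation ℝ A A
  /-- The covariant derivative, `nab X Y` being `∇_X Y`. -/
  nab : L →ₗ[A] L →+ L
  nab_smul (X : L) (a : A) (Y : L) : nab X (a • Y) = a • nab X Y + D X a • Y
  D_lie (X Y : L) (a : A) : D (nab X Y - nab Y X) a = D X (D Y a) - D Y (D X a)
  jacobi (X Y Z : L) :
    nab X (nab Y Z - nab Z Y) - nab (nab Y Z - nab Z Y) X =
      (nab (nab X Y - nab Y X) Z - nab Z (nab X Y - nab Y X)) +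
      (nab Y (nab X Z - nab Z X) - nab (nab X Z - nab Z X) Y)

namespace TorsionFreeConnection

variable (C : TorsionFreeConnection A L)

/-- The Lie bracket `[X, Y]`, recovered from the connection. -/
def lie (X Y : L) : L := C.nab X Y - C.nab Y X

/-- The curvature `R(X, Y)Z = ∇_X ∇_Y Z - ∇_Y ∇_X Z - ∇_[X,Y] Z`. -/
def curv (X Y Z : L) : L := C.nab X (C.nab Y Z) - C.nab Y (C.nab X Z) - C.nab (C.lie X Y) Z

lemma curv_swap (X Y Z : L) : C.curv Y X Z = -C.curv X Y Z := by
  simp only [curv, lie, map_sub, AddMonoidHom.sub_apply]; abel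

lemma curv_bianchi (X Y Z : L) : C.curv X Y Z + C.curv Y Z X + C.curv Z X Y = 0 := by
  have h := C.jacobi X Y Z
  simp only [curv, lie, map_sub, AddMonoidHom.sub_apply] at h ⊢
  rw [← sub_eq_zero] at h
  rw [← h]
  abel

lemma curv_add_left (X X' Y Z : L) : C.curv (X + X') Y Z = C.curv X Y Z + C.curv X' Y Z := by
  simp only [curv, lie, map_sub, map_add, AddMonoidHom.sub_apply, AddMonoidHom.add_apply]; abel

lemma curv_smul_left (a : A) (X Y Z : L) : C.curv (a • X) Y Z = a • C.curv X Y Z := by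
  simp only [curv, lie, map_sub, map_smul, AddMonoidHom.sub_apply, AddMonoidHom.smul_apply,
    nab_smul, map_add, AddMonoidHom.add_apply]
  module

lemma curv_add_right (X Y Z Z' : L) : C.curv X Y (Z + Z') = C.curv X Y Z + C.curv X Y Z' := by
  simp only [curv, map_add]; abel

lemma curv_smul_right (a : A) (X Y Z : L) : C.curv X Y (a • Z) = a • C.curv X Y Z := by
  have h := C.D_lie X Y a
  simp only [curv, lie, nab_smul, map_add, h]
  module

lemma curv_add_middle (X Y Y' Z : L) : C.curv X (Y + Y') Z = C.curv X Y Z + C.curv X Y' Z := by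
  rw [curv_swap, curv_add_left, curv_swap C X Y, curv_swap C X Y']; abel

lemma curv_smul_middle (a : A) (X Y Z : L) : C.curv X (a • Y) Z = a • C.curv X Y Z := by
  rw [curv_swap, curv_smul_left, curv_swap C X Y]; simp

/-- The endomorphism `X ↦ R(X, Y)Z`, whose trace is the Ricci tensor. -/
def curvEnd (Y Z : L) : L →ₗ[A] L where
  toFun X := C.curv X Y Z
  map_add' _ _ := C.curv_add_left ..
  map_smul' _ _ := C.curv_smul_left ..

@[simp] lemma curvEnd_apply (X Y Z : L) : C.curvEnd Y Z X = C.curv X Y Z := rfl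

/-- The covariant derivative `∇_N T = ∇_N ∘ T - T ∘ ∇_N` of an endomorphism `T`. -/
def nabEnd (N : L) (T : L →ₗ[A] L) : L →ₗ[A] L where
  toFun X := C.nab N (T X) - T (C.nab N X)
  map_add' _ _ := by simp only [map_add]; abel
  map_smul' _ _ := by simp only [map_smul, nab_smul, map_add, RingHom.id_apply]; module

lemma nabEnd_apply (N : L) (T : L →ₗ[A] L) (X : L) :
    C.nabEnd N T X = C.nab N (T X) - T (C.nab N X) := rfl

end TorsionFreeConnection

/-! ### Traces by means of local frames -/

variable (A L) in
/-- A local frame multiplied by a cut-off function: vector fields `vec i` and 1-forms `form i` with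
`∑ form i ⊗ vec i = cutoff • id`. On a manifold the cut-off function makes all these objects
globally defined. -/
structure LocalFrameData (ι : Type*) [Fintype ι] where
  /-- The vector fields of the frame. -/
  vec : ι → L
  /-- The 1-forms of the dual frame. -/
  form : ι → L →ₗ[A] A
  /-- The cut-off function. -/
  cutoff : A
  sum_form_smul_vec (X : L) : ∑ i, form i X • vec i = cutoff • X

namespace LocalFrameData

variable {ι κ : Type*} [Fintype ι] [Fintype κ] (F : LocalFrameData A L ι)
  (G : LocalFrameData A L κ)

/-- The trace of an endomorphism, multiplied by the cut-off function of the frame. -/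
def trace (T : L →ₗ[A] L) : A := ∑ i, F.form i (T (F.vec i))

omit [Algebra ℝ A] in
lemma sum_mul_form (H : L →ₗ[A] A) (X : L) :
    ∑ i, F.form i X * H (F.vec i) = F.cutoff * H X := by
  rw [← smul_eq_mul (a := F.cutoff), ← map_smul, ← F.sum_form_smul_vec, map_sum]
  simp

omit [Algebra ℝ A] in
/-- The trace does not depend on the frame, up to the cut-off functions. -/
lemma cutoff_mul_trace (T : L →ₗ[A] L) : G.cutoff * F.trace T = F.cutoff * G.trace T := by
  simp only [trace, Finset.mul_sum]
  have h1 (i : ι) := G.sum_mul_form (F.form i ∘ₗ T) (F.vec i)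
  have h2 (j : κ) := F.sum_mul_form (G.form j) (T (G.vec j))
  simp only [LinearMap.comp_apply] at h1
  simp only [← h1, ← h2]
  rw [Finset.sum_comm]
  exact Finset.sum_congr rfl fun j _ ↦ Finset.sum_congr rfl fun i _ ↦ mul_comm _ _

/-- The covariant derivative commutes with the trace: `N (tr T) = tr (∇_N T)`. With
`F.trace T = χ tr T` for the cut-off function `χ`, this reads
`χ (N (F.trace T) - F.trace (∇_N T)) = (N χ) F.trace T`. -/
lemma cutoff_mul_D_trace (C : TorsionFreeConnection A L) (N : L) (T : L →ₗ[A] L) :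
    F.cutoff * (C.D N (F.trace T) - F.trace (C.nabEnd N T)) = C.D N F.cutoff * F.trace T := by
  -- `δ i` is the covariant derivative along `N` of the 1-form `F.form i`.
  set δ : ι → L →ₗ[A] A := fun i ↦
    { toFun := fun X ↦ C.D N (F.form i X) - F.form i (C.nab N X)
      map_add' := fun _ _ ↦ by simp only [map_add]; abel
      map_smul' := fun _ _ ↦ by
        simp only [map_smul, C.nab_smul, map_add, RingHom.id_apply, smul_eq_mul, Derivation.leibniz]
        ring } with hδ
  have hδ' (i : ι) (X : L) : δ i X = C.D N (F.form i X) - F.form i (C.nab N X) := rfl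
  -- Differentiate `∑ form i X • vec i = χ • X` along `N`.
  have key (X : L) : ∑ i, δ i X • F.vec i =
      C.D N F.cutoff • X - ∑ i, F.form i X • C.nab N (F.vec i) := by
    have h := congr(C.nab N $(F.sum_form_smul_vec X))
    simp only [map_sum, C.nab_smul, Finset.sum_add_distrib] at h
    have h' := F.sum_form_smul_vec (C.nab N X)
    simp only [hδ', sub_smul, Finset.sum_sub_distrib, h']
    rw [← sub_eq_zero] at h ⊢
    rw [← h]; abel
  have h1 : C.D N (F.trace T) - F.trace (C.nabEnd N T) =
      ∑ i, δ i (T (F.vec i)) + ∑ i, F.form i (T (C.nab N (F.vec i))) := by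
    simp only [trace, map_sum, hδ', C.nabEnd_apply, map_sub, Finset.sum_sub_distrib]
    abel
  have h2 : F.cutoff * ∑ i, δ i (T (F.vec i)) =
      C.D N F.cutoff * F.trace T - F.cutoff * ∑ i, F.form i (T (C.nab N (F.vec i))) := by
    calc F.cutoff * ∑ i, δ i (T (F.vec i))
        = ∑ j, F.form j (T (∑ i, δ i (F.vec j) • F.vec i)) := by
          simp only [Finset.mul_sum, ← F.sum_mul_form (δ _), map_sum, map_smul, smul_eq_mul]
          rw [Finset.sum_comm]
          exact Finset.sum_congr rfl fun j _ ↦ Finset.sum_congr rfl fun i _ ↦ mul_comm _ _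
      _ = _ := by
          simp only [key, map_sub, map_sum, map_smul, Finset.sum_sub_distrib, smul_eq_mul,
            trace, Finset.mul_sum, ← F.sum_mul_form (F.form _)]
          congr 1
          rw [Finset.sum_comm]
          exact Finset.sum_congr rfl fun j _ ↦ Finset.sum_congr rfl fun i _ ↦ mul_comm _ _
  rw [h1, mul_add, h2]; ring

end LocalFrameData

/-! ### The Weyl connection of a Kenmotsu structure -/

variable (A L) in
/-- The algebraic model of a Kenmotsu pseudo-metric manifold: a torsion-free metric connection
together with an almost contact pseudo-metric structure satisfying the Kenmotsu condition. The sign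
`ε = ±1` is the element `e`. -/
structure KenmotsuCalculus extends TorsionFreeConnection A L where
  /-- The metric. -/
  g : L →ₗ[A] L →ₗ[A] A
  g_symm (X Y : L) : g X Y = g Y X
  g_nondeg (X : L) (h : ∀ Y, g X Y = 0) : X = 0
  D_g (X Y Z : L) : D X (g Y Z) = g (nab X Y) Z + g Y (nab X Z)
  /-- The tensor field of type `(1, 1)`. -/
  φ : L →ₗ[A] L
  /-- The Reeb vector field. -/
  ξ : L
  /-- The contact 1-form. -/
  η : L →ₗ[A] A
  /-- The sign `ε`. -/
  e : A
  e_mul_e : e * e = 1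
  D_e (X : L) : D X e = 0
  φ_φ (X : L) : φ (φ X) = -X + η X • ξ
  η_ξ : η ξ = 1
  φ_ξ : φ ξ = 0
  η_φ (X : L) : η (φ X) = 0
  g_φ_φ (X Y : L) : g (φ X) (φ Y) = g X Y - e * η X * η Y
  nab_φ (X Y : L) : nab X (φ Y) - φ (nab X Y) = -(η Y • φ X) - (e * g X (φ Y)) • ξ

namespace KenmotsuCalculus

lemma eq_of_two_mul {a b : A} (h : 2 * a = 2 * b) : a = b := by
  have h' := congr(algebraMap ℝ A (1 / 2) * $h)
  have h2 : algebraMap ℝ A (1 / 2) * 2 = 1 := by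
    rw [← map_ofNat (algebraMap ℝ A) 2, ← map_mul]; norm_num
  rwa [← mul_assoc, ← mul_assoc, h2, one_mul, one_mul] at h'

variable (K : KenmotsuCalculus A L)

lemma D_two (X : L) : K.D X (2 : A) = 0 := by
  rw [← map_ofNat (algebraMap ℝ A) 2]; exact Derivation.map_algebraMap _ _

lemma ext_g {X Y : L} (h : ∀ Z, K.g X Z = K.g Y Z) : X = Y := by
  rw [← sub_eq_zero]
  exact K.g_nondeg _ fun Z ↦ by simp [h]

lemma g_ξ (X : L) : K.g X K.ξ = K.e * K.η X := by
  have h := K.g_φ_φ X K.ξ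
  rw [K.φ_ξ, K.η_ξ, map_zero] at h
  linear_combination -h

lemma ξ_g (X : L) : K.g K.ξ X = K.e * K.η X := by rw [K.g_symm, K.g_ξ]

lemma nab_ξ (X : L) : K.nab X K.ξ = X - K.η X • K.ξ := by
  have h := K.nab_φ X K.ξ
  rw [K.φ_ξ, map_zero, map_zero, K.η_ξ, mul_zero, zero_smul] at h
  have h1 := congr(K.φ $h)
  simp only [zero_sub, one_smul, sub_zero, map_neg, K.φ_φ] at h1
  have h2 := K.D_g X K.ξ K.ξ
  rw [K.g_ξ, K.η_ξ, mul_one, K.D_e, K.ξ_g, K.g_ξ] at h2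
  have h3 : K.η (K.nab X K.ξ) = 0 := by
    apply eq_of_two_mul
    linear_combination (-K.e) * h2 - 2 * K.η (K.nab X K.ξ) * K.e_mul_e
  rw [h3] at h1
  linear_combination (norm := module) h1

lemma D_η (X Y : L) : K.D X (K.η Y) = K.η (K.nab X Y) + K.e * K.g X Y - K.η X * K.η Y := by
  have h := K.D_g X Y K.ξ
  rw [K.g_ξ, K.g_ξ, K.nab_ξ, Derivation.leibniz, K.D_e, map_sub, map_smul, K.g_ξ] at h
  simp only [smul_eq_mul] at h
  rw [K.g_symm X Y]
  linear_combination K.e * h - (K.D X (K.η Y) - K.η (K.nab X Y) + K.η X * K.η Y) * K.e_mul_e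

/-- The covariant derivative `∇_X Y - η(X) Y - η(Y) X + ε g(X, Y) ξ` of the Weyl connection. -/
def weylNab (X : L) : L →+ L :=
  AddMonoidHom.mk' (fun Y ↦ K.nab X Y - K.η X • Y - K.η Y • X + (K.e * K.g X Y) • K.ξ)
    fun Y Y' ↦ by simp only [map_add]; module

lemma weylNab_apply (X Y : L) :
    K.weylNab X Y = K.nab X Y - K.η X • Y - K.η Y • X + (K.e * K.g X Y) • K.ξ := rfl

/-- The correction term is symmetric, so the bracket is unchanged. -/
lemma weylNab_sub_swap (X Y : L) : K.weylNab X Y - K.weylNab Y X = K.nab X Y - K.nab Y X := by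
  rw [weylNab_apply, weylNab_apply, K.g_symm X Y]; module

/-- The Weyl connection of a Kenmotsu structure. Locally `η = dt` and the metric is a warped product
`ε dt² + e^{2t} h` with `h` Kähler; this is the Levi-Civita connection of the
product metric `e^{-2t} g`. Unlike `t`, it is globally defined. -/
def weyl : TorsionFreeConnection A L where
  D := K.D
  nab :=
    { toFun := K.weylNab
      map_add' := fun X X' ↦ by
        ext Y
        simp only [AddMonoidHom.add_apply, weylNab_apply, map_add, LinearMap.add_apply]
        module
      map_smul' := fun a X ↦ by
        ext Y
        simp only [AddMonoidHom.smul_apply, weylNab_apply, map_smul, LinearMap.smul_apply,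
          smul_eq_mul, RingHom.id_apply]
        module }
  nab_smul X a Y := by
    change K.weylNab X (a • Y) = a • K.weylNab X Y + K.D X a • Y
    simp only [weylNab_apply, map_smul, K.nab_smul, smul_eq_mul]
    module
  D_lie X Y a := by
    rw [← K.D_lie, ← K.weylNab_sub_swap]
    rfl
  jacobi X Y Z := by
    have h := K.jacobi X Y Z
    simp only [← K.weylNab_sub_swap] at h
    exact h

lemma weyl_nab (X Y : L) :
    K.weyl.nab X Y = K.nab X Y - K.η X • Y - K.η Y • X + (K.e * K.g X Y) • K.ξ := rfl

lemma weyl_D : K.weyl.D = K.D := rfl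

lemma weyl_lie (X Y : L) : K.weyl.lie X Y = K.lie X Y :=
  K.weylNab_sub_swap X Y

lemma weyl_nab_ξ (X : L) : K.weyl.nab X K.ξ = -(K.η X • K.ξ) := by
  rw [weyl_nab, K.nab_ξ, K.η_ξ, K.g_ξ, ← mul_assoc, K.e_mul_e]; module

lemma weyl_D_η (X Y : L) : K.D X (K.η Y) = K.η (K.weyl.nab X Y) + K.η X * K.η Y := by
  rw [K.D_η, weyl_nab]
  simp only [map_add, map_sub, map_smul, smul_eq_mul, K.η_ξ]
  ring

lemma weyl_D_g (X Y Z : L) : K.D X (K.g Y Z) =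
    K.g (K.weyl.nab X Y) Z + K.g Y (K.weyl.nab X Z) + 2 * K.η X * K.g Y Z := by
  rw [K.D_g, weyl_nab, weyl_nab]
  simp only [map_add, map_sub, map_smul, smul_eq_mul, LinearMap.add_apply, LinearMap.sub_apply,
    LinearMap.smul_apply, K.g_ξ, K.ξ_g, K.g_symm Y X]
  linear_combination (-(K.g X Y * K.η Z) - K.g X Z * K.η Y) * K.e_mul_e

/-- `φ` is parallel for the Weyl connection. -/
lemma weyl_nab_φ (X Y : L) : K.weyl.nab X (K.φ Y) = K.φ (K.weyl.nab X Y) := by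
  have h := K.nab_φ X Y
  rw [weyl_nab, weyl_nab]
  simp only [map_add, map_sub, map_smul, K.φ_ξ, K.η_φ]
  linear_combination (norm := module) h

lemma η_lie (X Y : L) : K.η (K.weyl.lie X Y) = K.D X (K.η Y) - K.D Y (K.η X) := by
  rw [TorsionFreeConnection.lie, map_sub, weyl_D_η, weyl_D_η]; ring

lemma D_weyl_lie (X Y : L) (a : A) :
    K.D (K.weyl.lie X Y) a = K.D X (K.D Y a) - K.D Y (K.D X a) := K.weyl.D_lie X Y a

/-- The two curvatures differ by a curvature tensor of constant curvature `-ε`. -/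
lemma curv_eq (X Y Z : L) : K.curv X Y Z =
    K.weyl.curv X Y Z - K.e • (K.g Y Z • X - K.g X Z • Y) := by
  have hl : K.weyl.lie X Y = K.nab X Y - K.nab Y X := K.weyl_lie X Y
  simp only [TorsionFreeConnection.curv, hl]
  simp only [TorsionFreeConnection.lie, weyl_nab, map_add, map_sub, map_smul, smul_eq_mul,
    K.nab_smul, AddMonoidHom.sub_apply, K.g_ξ, K.nab_ξ, Derivation.leibniz, K.D_e, K.D_η, K.D_g,
    K.η_ξ, smul_sub]
  rw [K.g_symm Y X]
  have he : (K.e * K.e) • K.ξ = K.ξ := by rw [K.e_mul_e, one_smul]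
  linear_combination (norm := module) (K.e * (K.η Y * K.g X Z - K.g Y Z * K.η X)) • he

/-! ### Curvature of the Weyl connection -/

lemma weyl_curv_skew (X Y Z T : L) :
    K.g (K.weyl.curv X Y Z) T = -K.g Z (K.weyl.curv X Y T) := by
  have h3 := K.D_weyl_lie X Y (K.g Z T)
  have h4 := K.weyl_D_g (K.weyl.lie X Y) Z T
  have h5 := K.η_lie X Y
  rw [h4, h5] at h3
  simp only [weyl_D_g, map_add, Derivation.leibniz, smul_eq_mul, K.D_two] at h3
  simp only [TorsionFreeConnection.curv, map_sub, LinearMap.sub_apply]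
  linear_combination -h3

/-- Pair symmetry, obtained from skew-symmetry and the first Bianchi identity as usual. -/
lemma weyl_curv_pair_symm (X Y Z T : L) :
    K.g (K.weyl.curv X Y Z) T = K.g (K.weyl.curv Z T X) Y := by
  have B (X Y Z T : L) : K.g (K.weyl.curv X Y Z) T + K.g (K.weyl.curv Y Z X) T
      + K.g (K.weyl.curv Z X Y) T = 0 := by
    rw [← LinearMap.add_apply, ← LinearMap.add_apply, ← map_add, ← map_add, K.weyl.curv_bianchi]
    simp
  have S (X Y Z T : L) : K.g (K.weyl.curv X Y Z) T = -K.g (K.weyl.curv X Y T) Z := by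
    rw [weyl_curv_skew, K.g_symm]
  have W (X Y Z T : L) : K.g (K.weyl.curv X Y Z) T = -K.g (K.weyl.curv Y X Z) T := by
    rw [K.weyl.curv_swap]; simp
  apply eq_of_two_mul
  linear_combination B X Y Z T + B Y Z T X - B Z T X Y - B T X Y Z + S X Y Z T - S Z T X Y
    - S Y Z X T + S T X Z Y + S X Z T Y - W Z X Y T + S Y T X Z - W T Y Z X

lemma weyl_curv_φ (X Y Z : L) : K.weyl.curv X Y (K.φ Z) = K.φ (K.weyl.curv X Y Z) := by
  simp only [TorsionFreeConnection.curv, weyl_nab_φ, map_sub]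

lemma weyl_curv_ξ (X Y : L) : K.weyl.curv X Y K.ξ = 0 := by
  have h := K.η_lie X Y
  simp only [TorsionFreeConnection.curv, weyl_nab_ξ, map_neg, K.weyl.nab_smul, h, weyl_D]
  module

lemma weyl_curv_ξ_left (X Y : L) : K.weyl.curv K.ξ X Y = 0 :=
  K.ext_g fun Z ↦ by rw [weyl_curv_pair_symm, weyl_curv_ξ]; simp

lemma weyl_curv_ξ_middle (X Y : L) : K.weyl.curv X K.ξ Y = 0 := by
  rw [K.weyl.curv_swap, weyl_curv_ξ_left, neg_zero]

lemma η_weyl_curv (X Y Z : L) : K.η (K.weyl.curv X Y Z) = 0 := by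
  have h := K.weyl_curv_skew X Y Z K.ξ
  rw [weyl_curv_ξ, K.g_ξ, map_zero, neg_zero] at h
  linear_combination K.e * h - K.η (K.weyl.curv X Y Z) * K.e_mul_e

/-- The Kähler identity `R(φX, φY) = R(X, Y)`. By pair symmetry it says that the curvature
commutes with `φ`. -/
lemma weyl_curv_φ_φ (X Y Z : L) : K.weyl.curv (K.φ X) (K.φ Y) Z = K.weyl.curv X Y Z := by
  refine K.ext_g fun T ↦ ?_
  rw [weyl_curv_pair_symm, weyl_curv_φ, K.g_φ_φ, η_weyl_curv, weyl_curv_pair_symm]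
  ring

/-- As `R(ξ, ·) = 0`, covariant derivatives along `ξ` and `X` commute up to `[ξ, X]`. -/
lemma weyl_nab_ξ_nab (X Y : L) : K.weyl.nab K.ξ (K.weyl.nab X Y) =
    K.weyl.nab X (K.weyl.nab K.ξ Y) + K.weyl.nab (K.weyl.lie K.ξ X) Y := by
  have h := K.weyl_curv_ξ_left X Y
  rw [TorsionFreeConnection.curv] at h
  linear_combination (norm := module) h

lemma weyl_lie_ξ (X : L) : K.weyl.lie K.ξ X = K.weyl.nab K.ξ X + K.η X • K.ξ := by
  rw [TorsionFreeConnection.lie, weyl_nab_ξ, sub_neg_eq_add]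

/-- The curvature is parallel along `ξ`. The vector fields `∇_ξ X` and `[ξ, X]` differ by a multiple
of `ξ`, which is invisible to the curvature; so the Jacobi identity suffices. -/
lemma weyl_nab_ξ_curv (X Y Z : L) : K.weyl.nab K.ξ (K.weyl.curv X Y Z) =
    K.weyl.curv (K.weyl.nab K.ξ X) Y Z + K.weyl.curv X (K.weyl.nab K.ξ Y) Z +
      K.weyl.curv X Y (K.weyl.nab K.ξ Z) := by
  have hX : K.weyl.curv (K.weyl.nab K.ξ X) Y Z = K.weyl.curv (K.weyl.lie K.ξ X) Y Z := by
    rw [weyl_lie_ξ, K.weyl.curv_add_left, K.weyl.curv_smul_left, weyl_curv_ξ_left, smul_zero,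
      add_zero]
  have hY : K.weyl.curv X (K.weyl.nab K.ξ Y) Z = K.weyl.curv X (K.weyl.lie K.ξ Y) Z := by
    rw [weyl_lie_ξ, K.weyl.curv_add_middle, K.weyl.curv_smul_middle, weyl_curv_ξ_middle,
      smul_zero, add_zero]
  have hJ : K.weyl.lie K.ξ (K.weyl.lie X Y) =
    K.weyl.lie (K.weyl.lie K.ξ X) Y + K.weyl.lie X (K.weyl.lie K.ξ Y) := K.weyl.jacobi K.ξ X Y
  rw [hX, hY]
  simp only [TorsionFreeConnection.curv, map_sub, map_add, weyl_nab_ξ_nab, hJ,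
    AddMonoidHom.add_apply]
  module

/-- Differentiating the Ricci trace along `ξ`. If the Ricci tensor of the Weyl connection is
`-e b (g - e η ⊗ η)`, then `(ξ b + 2 b) (g - e η ⊗ η)` vanishes wherever the frame is
defined: the curvature is parallel along `ξ`, while `g - e η ⊗ η` is doubled. -/
lemma cutoff_mul_D_ξ_add {ι : Type*} [Fintype ι] (F : LocalFrameData A L ι) {b : A}
    (hF : ∀ Y Z, F.trace (K.weyl.curvEnd Y Z) =
      F.cutoff * -(K.e * b * (K.g Y Z - K.e * K.η Y * K.η Z))) (Y Z : L) :
    F.cutoff * F.cutoff * ((K.D K.ξ b + 2 * b) * (K.g Y Z - K.e * K.η Y * K.η Z)) = 0 := by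
  have h1 : K.weyl.nabEnd K.ξ (K.weyl.curvEnd Y Z) =
      K.weyl.curvEnd (K.weyl.nab K.ξ Y) Z + K.weyl.curvEnd Y (K.weyl.nab K.ξ Z) := by
    ext X
    simp only [TorsionFreeConnection.nabEnd_apply, TorsionFreeConnection.curvEnd_apply,
      LinearMap.add_apply, weyl_nab_ξ_curv]
    abel
  have h2 : F.trace (K.weyl.nabEnd K.ξ (K.weyl.curvEnd Y Z)) =
      F.trace (K.weyl.curvEnd (K.weyl.nab K.ξ Y) Z) +
        F.trace (K.weyl.curvEnd Y (K.weyl.nab K.ξ Z)) := by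
    rw [h1]
    simp only [LocalFrameData.trace, LinearMap.add_apply, map_add, Finset.sum_add_distrib]
  have h3 := F.cutoff_mul_D_trace K.weyl K.ξ (K.weyl.curvEnd Y Z)
  rw [h2, hF, hF, hF, weyl_D] at h3
  simp only [map_neg, map_sub, Derivation.leibniz, weyl_D_g, weyl_D_η, smul_eq_mul, K.D_e,
    K.η_ξ] at h3
  linear_combination -K.e * h3 - (F.cutoff * F.cutoff *
    ((K.D K.ξ b + 2 * b) * (K.g Y Z - K.e * K.η Y * K.η Z))) * K.e_mul_e

/-! ### Ricci solitons on an `η`-Einstein Kenmotsu module -/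

/-- The Ricci soliton equation on an `η`-Einstein Kenmotsu module with `Ric = a g + b η ⊗ η`, where
`a = -ε (2n + b)` is already inserted and `c = 2n ε - λ`, together with the equation
`ξ b = -2 b`. -/
structure IsSoliton (V : L) (b c : A) : Prop where
  lie_g (X Y : L) : K.g (K.nab X V) Y + K.g X (K.nab Y V) =
    2 * (c + K.e * b) * K.g X Y - 2 * b * K.η X * K.η Y
  D_c (X : L) : K.D X c = 0
  D_ξ_b : K.D K.ξ b = -2 * b

/-- The horizontal part of a vector field. -/
def hor (V : L) : L := V - K.η V • K.ξ

/-- The field `-ε ∇_ξ (hor V)` for the Weyl connection. For a Ricci soliton it is the horizontal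
gradient of the function `η V`, see `IsSoliton.g_solitonGrad`. -/
def solitonGrad (V : L) : L := -(K.e • K.weyl.nab K.ξ (K.hor V))

lemma η_hor (V : L) : K.η (K.hor V) = 0 := by simp [hor, K.η_ξ]

lemma η_weyl_nab {X : L} (hX : K.η X = 0) (Y : L) : K.η (K.weyl.nab Y X) = 0 := by
  have h := K.weyl_D_η Y X
  rw [hX] at h; simpa using h.symm

lemma η_solitonGrad (V : L) : K.η (K.solitonGrad V) = 0 := by
  simp [solitonGrad, η_weyl_nab, η_hor]

lemma weyl_nab_hor (X V : L) : K.weyl.nab X V =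
    K.weyl.nab X (K.hor V) + (K.D X (K.η V) - K.η V * K.η X) • K.ξ := by
  rw [hor, map_sub, K.weyl.nab_smul, weyl_nab_ξ, weyl_D]; module

variable {K} {V : L} {b c : A} (h : K.IsSoliton V b c)
include h

namespace IsSoliton

lemma weyl_lie_g (X Y : L) : K.g (K.weyl.nab X V) Y + K.g X (K.weyl.nab Y V) =
    2 * (c + K.e * b - K.η V) * K.g X Y - 2 * b * K.η X * K.η Y := by
  have h1 := h.lie_g X Y
  rw [weyl_nab, weyl_nab]
  simp only [map_add, map_sub, map_smul, smul_eq_mul, LinearMap.add_apply, LinearMap.sub_apply,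
    LinearMap.smul_apply, K.g_ξ, K.ξ_g]
  linear_combination h1 + (K.g X V * K.η Y + K.g Y V * K.η X) * K.e_mul_e +
    K.η X * K.g_symm Y V

lemma D_ξ_η : K.D K.ξ (K.η V) = c := by
  have h1 := h.weyl_lie_g K.ξ K.ξ
  have h2 := K.weyl_D_η K.ξ V
  simp only [K.g_ξ, K.ξ_g, K.η_ξ, one_mul, mul_one] at h1 h2
  apply eq_of_two_mul
  linear_combination 2 * h2 + K.e * h1 +
    (2 * c - 2 * K.η V + 2 * K.e * b - 2 * K.η (K.weyl.nab K.ξ V)) * K.e_mul_e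

lemma g_solitonGrad (X : L) : K.g (K.solitonGrad V) X = K.D X (K.η V) - c * K.η X := by
  have h1 := h.weyl_lie_g X K.ξ
  have h2 := h.D_ξ_η
  have h3 := K.η_weyl_nab (K.η_hor V) X
  rw [K.weyl_nab_hor X V, K.weyl_nab_hor K.ξ V, h2] at h1
  simp only [map_add, map_smul, smul_eq_mul, LinearMap.add_apply, LinearMap.smul_apply,
    K.g_ξ, K.η_ξ, h3] at h1
  simp only [solitonGrad, map_neg, map_smul, LinearMap.neg_apply, LinearMap.smul_apply,
    smul_eq_mul, K.g_symm _ X]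
  linear_combination -K.e * h1 +
    (K.D X (K.η V) - c * K.η X - 2 * K.e * b * K.η X) * K.e_mul_e

lemma hor_lie_g {X Y : L} (hX : K.η X = 0) (hY : K.η Y = 0) :
    K.g (K.weyl.nab X (K.hor V)) Y + K.g X (K.weyl.nab Y (K.hor V)) =
      2 * (c + K.e * b - K.η V) * K.g X Y := by
  have h1 := h.weyl_lie_g X Y
  rw [K.weyl_nab_hor X V, K.weyl_nab_hor Y V] at h1
  simp only [map_add, map_smul, smul_eq_mul, LinearMap.add_apply, LinearMap.smul_apply,
    K.g_ξ, K.ξ_g, hX, hY] at h1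
  linear_combination h1

/-- The equation `IsSoliton.hor_lie_g`, differentiated along `ξ`. -/
lemma hor_lie_solitonGrad {X Y : L} (hX : K.η X = 0) (hY : K.η Y = 0) :
    K.g (K.weyl.nab X (K.solitonGrad V)) Y + K.g X (K.weyl.nab Y (K.solitonGrad V)) =
      2 * (2 * b + K.e * c) * K.g X Y := by
  have h0 := congr(K.D K.ξ $(h.hor_lie_g hX hY))
  have h1 := h.hor_lie_g (K.η_weyl_nab hX K.ξ) hY
  have h2 := h.hor_lie_g hX (K.η_weyl_nab hY K.ξ)
  have h3 := h.hor_lie_g hX hY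
  have hU : K.weyl.nab K.ξ (K.hor V) = -(K.e • K.solitonGrad V) := by
    rw [solitonGrad, smul_neg, neg_neg, smul_smul, K.e_mul_e, one_smul]
  simp only [map_add, map_sub, Derivation.leibniz, weyl_D_g, weyl_nab_ξ_nab, weyl_lie_ξ, hX, hY,
    zero_smul, add_zero, smul_eq_mul, K.η_ξ, K.D_two, K.D_e, h.D_c, h.D_ξ_b, h.D_ξ_η, hU, map_neg,
    K.weyl.nab_smul, weyl_D, LinearMap.add_apply, LinearMap.neg_apply, LinearMap.smul_apply,
    map_smul] at h0
  linear_combination -K.e * (h0 - h1 - h2 - 2 * h3) -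
    (K.g (K.weyl.nab X (K.solitonGrad V)) Y + K.g X (K.weyl.nab Y (K.solitonGrad V)) -
      4 * b * K.g X Y) * K.e_mul_e

/-- The Hessian of `η V` is symmetric on horizontal fields. -/
lemma hessian_symm {X Y : L} (hX : K.η X = 0) (hY : K.η Y = 0) :
    K.g (K.weyl.nab X (K.solitonGrad V)) Y = K.g X (K.weyl.nab Y (K.solitonGrad V)) := by
  have h1 := congr(K.D X $(h.g_solitonGrad Y))
  have h2 := congr(K.D Y $(h.g_solitonGrad X))
  have h3 := h.g_solitonGrad (K.weyl.lie X Y)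
  rw [D_weyl_lie, η_lie] at h3
  simp only [weyl_D_g, hX, hY, map_sub, Derivation.leibniz, h.D_c, smul_eq_mul, map_zero]
    at h1 h2 h3
  simp only [TorsionFreeConnection.lie, map_sub] at h3
  rw [K.g_symm X]
  linear_combination h1 - h2 - h3

lemma weyl_nab_solitonGrad {X : L} (hX : K.η X = 0) :
    K.weyl.nab X (K.solitonGrad V) = (2 * b + K.e * c) • X := by
  refine K.ext_g fun Y ↦ ?_
  have h1 := h.hor_lie_solitonGrad hX (K.η_hor Y)
  rw [← h.hessian_symm hX (K.η_hor Y)] at h1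
  have h2 : Y = K.hor Y + K.η Y • K.ξ := by simp [hor]
  have h3 := K.η_weyl_nab (K.η_solitonGrad V) X
  rw [h2]
  apply eq_of_two_mul
  simp only [map_add, map_smul, LinearMap.smul_apply, K.g_ξ, smul_eq_mul, hX, h3]
  linear_combination h1

lemma weyl_curv_solitonGrad {X Y : L} (hX : K.η X = 0) (hY : K.η Y = 0) :
    K.weyl.curv X Y (K.solitonGrad V) = (2 * K.D X b) • Y - (2 * K.D Y b) • X := by
  have hl : K.η (K.weyl.lie X Y) = 0 := by rw [η_lie, hX, hY]; simp
  rw [TorsionFreeConnection.curv, h.weyl_nab_solitonGrad hX, h.weyl_nab_solitonGrad hY,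
    h.weyl_nab_solitonGrad hl]
  simp only [K.weyl.nab_smul, weyl_D, TorsionFreeConnection.lie, map_add, Derivation.leibniz,
    K.D_two, K.D_e, h.D_c, smul_eq_mul]
  module

/-- On horizontal fields, `R(X, Y)U = 2 ((X b) Y - (Y b) X)` for the gradient `U` of `η V`; the
Kähler identity equates it with the same expression in `φX` and `φY`. -/
lemma D_smul_sub {X Y : L} (hX : K.η X = 0) (hY : K.η Y = 0) :
    K.D X b • Y - K.D Y b • X =
      K.D (K.φ X) b • K.φ Y - K.D (K.φ Y) b • K.φ X := by
  have h1 := K.weyl_curv_φ_φ X Y (K.solitonGrad V)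
  rw [h.weyl_curv_solitonGrad hX hY, h.weyl_curv_solitonGrad (K.η_φ X) (K.η_φ Y)] at h1
  refine K.ext_g fun Z ↦ ?_
  have h2 := congr(K.g $h1 Z)
  apply eq_of_two_mul
  simp only [map_sub, map_smul, LinearMap.sub_apply, LinearMap.smul_apply, smul_eq_mul] at h2 ⊢
  linear_combination -h2

lemma weyl_curv_solitonGrad_eq_zero (hD : ∀ X, K.η X = 0 → K.D X b = 0) (X Y : L) :
    K.weyl.curv X Y (K.solitonGrad V) = 0 := by
  have hh (X : L) : X = K.hor X + K.η X • K.ξ := by simp [hor]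
  rw [hh X, hh Y, K.weyl.curv_add_left, K.weyl.curv_smul_left, weyl_curv_ξ_left,
    K.weyl.curv_add_middle, K.weyl.curv_smul_middle, weyl_curv_ξ_middle,
    h.weyl_curv_solitonGrad (K.η_hor X) (K.η_hor Y), hD _ (K.η_hor X), hD _ (K.η_hor Y)]
  simp

lemma mul_smul_eq_zero (hD : ∀ X, K.η X = 0 → K.D X b = 0)
    (hU : b • K.solitonGrad V = 0) {X : L} (hX : K.η X = 0) :
    (b * (2 * b + K.e * c)) • X = 0 := by
  have h1 := congr(K.weyl.nab X $hU)
  rw [K.weyl.nab_smul, h.weyl_nab_solitonGrad hX, weyl_D, hD X hX] at h1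
  simpa [mul_smul] using h1

lemma mul_self_eq_zero_of (hz : b * (2 * b + K.e * c) = 0) : 4 * (b * b) = 0 := by
  have h1 := congr(K.D K.ξ $hz)
  simp only [map_add, Derivation.leibniz, K.D_two, h.D_c, K.D_e, h.D_ξ_b, smul_eq_mul,
    map_zero] at h1
  linear_combination -h1 - 2 * hz

end IsSoliton

end KenmotsuCalculus

end Algebra

noncomputable section

/-! ### Smooth functions and vector fields -/

section SmoothFields

variable (E : Type*) [NormedAddCommGroup E] [NormedSpace ℝ E]
  (M : Type*) [TopologicalSpace M] [ChartedSpace E M]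

/-- The ring of smooth real functions on `M`. -/
abbrev SmoothFun := C^∞⟮𝓘(ℝ, E), M; 𝓘(ℝ, ℝ), ℝ⟯

variable {E M} in
lemma SmoothFun.two_apply (x : M) : (2 : SmoothFun E M) x = 2 := by
  rw [← map_ofNat (algebraMap ℝ (SmoothFun E M)) 2]; rfl

variable [IsManifold 𝓘(ℝ, E) ∞ M]

/-- The smooth vector fields on `M`. -/
abbrev SmoothField := Cₛ^∞⟮𝓘(ℝ, E); E, (TangentSpace 𝓘(ℝ, E) : M → Type _)⟯

variable {E M}

instance : SMul (SmoothFun E M) (SmoothField E M) :=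
  ⟨fun f X ↦ ⟨(f : M → ℝ) • (X : Π x : M, TangentSpace 𝓘(ℝ, E) x),
    f.contMDiff.smul_section X.contMDiff⟩⟩

namespace SmoothField

lemma coe_fun_smul (f : SmoothFun E M) (X : SmoothField E M) :
    ⇑(f • X) = (f : M → ℝ) • (X : Π x : M, TangentSpace 𝓘(ℝ, E) x) := rfl

@[simp] lemma smul_apply (f : SmoothFun E M) (X : SmoothField E M) (x : M) :
    (f • X) x = f x • X x := rfl

@[simp] lemma add_apply (X Y : SmoothField E M) (x : M) : (X + Y) x = X x + Y x := rfl
@[simp] lemma sub_apply (X Y : SmoothField E M) (x : M) : (X - Y) x = X x - Y x := rfl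
@[simp] lemma neg_apply (X : SmoothField E M) (x : M) : (-X) x = -X x := rfl
@[simp] lemma zero_apply (x : M) : (0 : SmoothField E M) x = 0 := rfl

instance : Module (SmoothFun E M) (SmoothField E M) where
  one_smul X := by ext x; exact one_smul ℝ (X x)
  mul_smul f h X := by ext x; exact mul_smul (f x) (h x) (X x)
  smul_zero f := by ext x; exact smul_zero (f x)
  smul_add f X Y := by ext x; exact smul_add (f x) (X x) (Y x)
  add_smul f h X := by ext x; exact add_smul (f x) (h x) (X x)
  zero_smul X := by ext x; exact zero_smul ℝ (X x)

@[simp] lemma sum_apply {ι : Type*} (s : Finset ι) (X : ι → SmoothField E M) (x : M) :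
    (∑ i ∈ s, X i) x = ∑ i ∈ s, X i x := by
  classical
  induction s using Finset.induction_on with
  | empty => simp
  | insert i s hi ih => simp [Finset.sum_insert hi, ih]

lemma mdiffAt (X : SmoothField E M) (x : M) : MDiffAt (T% (fun y ↦ X y)) x :=
  X.mdifferentiableAt

lemma contMDiff_mvfderiv (X : SmoothField E M) (f : SmoothFun E M) :
    ContMDiff 𝓘(ℝ, E) 𝓘(ℝ, ℝ) ∞ (fun x ↦ mvfderiv 𝓘(ℝ, E) f x (X x)) := by
  have h1 : ContMDiff 𝓘(ℝ, E).tangent 𝓘(ℝ, ℝ).tangent ∞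
      (tangentMap 𝓘(ℝ, E) 𝓘(ℝ, ℝ) f) :=
    f.contMDiff.contMDiff_tangentMap (by simp)
  have h2 := (contMDiff_snd_tangentBundle_modelSpace (n := ∞) ℝ 𝓘(ℝ, ℝ)).comp
    (h1.comp X.contMDiff)
  exact h2

/-- A smooth vector field as a derivation of the ring of smooth functions. -/
def derivation (X : SmoothField E M) : Derivation ℝ (SmoothFun E M) (SmoothFun E M) :=
  Derivation.mk'
    { toFun := fun f ↦ ⟨fun x ↦ mvfderiv 𝓘(ℝ, E) f x (X x), X.contMDiff_mvfderiv f⟩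
      map_add' := fun f h ↦ by
        ext x
        exact congr($(mvfderiv_add (f.mdifferentiableAt (x := x)) h.mdifferentiableAt) (X x))
      map_smul' := fun r f ↦ by
        ext x
        have h := mvfderiv_mul (I := 𝓘(ℝ, E)) (mdifferentiableAt_const (c := r) (x := x))
          (f.mdifferentiableAt (x := x))
        have h' := congr($h (X x))
        simp only [mvfderiv_const, smul_zero, add_zero] at h'
        exact h' }
    (fun f h ↦ by
      ext x
      have h' := congr($(mvfderiv_mul (f.mdifferentiableAt (x := x)) h.mdifferentiableAt) (X x))
      exact h')

lemma derivation_apply (X : SmoothField E M) (f : SmoothFun E M) (x : M) :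
    X.derivation f x = mvfderiv 𝓘(ℝ, E) f x (X x) := rfl

variable [CompleteSpace E]

omit [CompleteSpace E] in
variable (E M) in
lemma isManifold_minSmoothness {k : ℕ∞} : IsManifold 𝓘(ℝ, E) (minSmoothness ℝ k) M := by
  rw [minSmoothness_of_isRCLikeNormedField]
  exact IsManifold.of_le (n := ∞) (by exact_mod_cast le_top)

/-- The Lie bracket of smooth vector fields. -/
def bracket (X Y : SmoothField E M) : SmoothField E M where
  toFun := VectorField.mlieBracket 𝓘(ℝ, E) X Y
  contMDiff_toFun := by
    have : IsManifold 𝓘(ℝ, E) (((⊤ : ℕ∞) : ℕ∞ω) + 1) M := by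
      simpa using (inferInstance : IsManifold 𝓘(ℝ, E) ∞ M)
    have : IsManifold 𝓘(ℝ, E) (minSmoothness ℝ 2) M := isManifold_minSmoothness E M (k := 2)
    exact ContDiff.mlieBracket_vectorField (m := ⊤) (n := ⊤) X.contMDiff Y.contMDiff
      (by simp)

lemma bracket_apply (X Y : SmoothField E M) (x : M) :
    X.bracket Y x = VectorField.mlieBracket 𝓘(ℝ, E) X Y x := rfl

lemma bracket_smul (X Y : SmoothField E M) (f : SmoothFun E M) :
    X.bracket (f • Y) = f • X.bracket Y + X.derivation f • Y := by
  ext x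
  have := VectorField.mlieBracket_smul_right (I := 𝓘(ℝ, E)) (V := X) (W := Y)
    (f.mdifferentiableAt (x := x)) (Y.mdiffAt x)
  simp only [bracket_apply, coe_fun_smul, add_apply, smul_apply, derivation_apply, this]
  rw [add_comm]

lemma bracket_add (X Y Z : SmoothField E M) :
    X.bracket (Y + Z) = X.bracket Y + X.bracket Z := by
  ext x
  exact VectorField.mlieBracket_add_right (I := 𝓘(ℝ, E)) (V := X) (Y.mdiffAt x) (Z.mdiffAt x)

lemma bracket_jacobi (X Y Z : SmoothField E M) :
    X.bracket (Y.bracket Z) = (X.bracket Y).bracket Z + Y.bracket (X.bracket Z) := by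
  have : IsManifold 𝓘(ℝ, E) (minSmoothness ℝ 3) M := isManifold_minSmoothness E M (k := 3)
  have hle : minSmoothness ℝ 2 ≤ ∞ := by
    rw [minSmoothness_of_isRCLikeNormedField]
    exact WithTop.coe_le_coe.2 (le_top : (2 : ℕ∞) ≤ ⊤)
  ext x
  exact VectorField.leibniz_identity_mlieBracket_apply (I := 𝓘(ℝ, E))
    (X.contMDiff.of_le hle x) (Y.contMDiff.of_le hle x) (Z.contMDiff.of_le hle x)

end SmoothField

end SmoothFields

/-! ### Cut-off functions, global extensions and frames -/

section Frames

variable {E : Type*} [NormedAddCommGroup E] [NormedSpace ℝ E] [FiniteDimensional ℝ E]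
  {M : Type*} [TopologicalSpace M] [ChartedSpace E M] [IsManifold 𝓘(ℝ, E) ∞ M] [T2Space M]

namespace SmoothField

variable (E) in
/-- A bump function centred at `x`. -/
def bump (x : M) : SmoothBumpFunction 𝓘(ℝ, E) x := Classical.choice inferInstance

variable (E) in
lemma tsupport_bump (x : M) :
    tsupport (bump E x) ⊆ (trivializationAt E (TangentSpace 𝓘(ℝ, E) : M → Type _) x).baseSet :=
  (bump E x).tsupport_subset_chartAt_source

variable (E) in
/-- The bump function centred at `x` as an element of the ring of smooth functions. -/
def bumpFun (x : M) : SmoothFun E M := ⟨bump E x, (bump E x).contMDiff⟩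

variable (E) in
lemma bumpFun_eventuallyEq (x : M) : ∀ᶠ y in 𝓝 x, bumpFun E x y = 1 :=
  (bump E x).eventuallyEq_one

/-- The globally smooth product of a bump function at `x` and a field smooth near `x`. -/
def bumpSMul (x : M) (X : Π y : M, TangentSpace 𝓘(ℝ, E) y)
    (hX : ContMDiffOn 𝓘(ℝ, E) 𝓘(ℝ, E).tangent ∞ (T% X)
      (trivializationAt E (TangentSpace 𝓘(ℝ, E) : M → Type _) x).baseSet) : SmoothField E M :=
  ⟨(bump E x : M → ℝ) • X, ContMDiffOn.smul_section_of_tsupport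
    (bump E x).contMDiff.contMDiffOn
    (trivializationAt E (TangentSpace 𝓘(ℝ, E) : M → Type _) x).open_baseSet (tsupport_bump E x) hX⟩

lemma bumpSMul_apply (x : M) (X : Π y : M, TangentSpace 𝓘(ℝ, E) y)
    (hX : ContMDiffOn 𝓘(ℝ, E) 𝓘(ℝ, E).tangent ∞ (T% X)
      (trivializationAt E (TangentSpace 𝓘(ℝ, E) : M → Type _) x).baseSet) (y : M) :
    bumpSMul x X hX y = bumpFun E x y • X y := rfl

lemma bumpSMul_eventuallyEq (x : M) (X : Π y : M, TangentSpace 𝓘(ℝ, E) y)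
    (hX : ContMDiffOn 𝓘(ℝ, E) 𝓘(ℝ, E).tangent ∞ (T% X)
      (trivializationAt E (TangentSpace 𝓘(ℝ, E) : M → Type _) x).baseSet) :
    ∀ᶠ y in 𝓝 x, bumpSMul x X hX y = X y := by
  filter_upwards [bumpFun_eventuallyEq E x] with y hy
  rw [bumpSMul_apply, hy, one_smul]

lemma exists_eventuallyEq_extend (x : M) (v : TangentSpace 𝓘(ℝ, E) x) :
    ∃ X : SmoothField E M, ∀ᶠ y in 𝓝 x, X y = FiberBundle.extend E v y := by
  refine ⟨_, bumpSMul_eventuallyEq x (FiberBundle.extend E v) ?_⟩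
  rw [Trivialization.contMDiffOn_section_baseSet_iff]
  refine (contMDiffOn_const (c :=
    (trivializationAt E (TangentSpace 𝓘(ℝ, E) : M → Type _) x ⟨x, v⟩).2)).congr fun y hy ↦ ?_
  simp only [FiberBundle.extend]
  rw [Trivialization.apply_mk_symm _ hy]

lemma exists_apply_eq (x : M) (v : TangentSpace 𝓘(ℝ, E) x) :
    ∃ X : SmoothField E M, X x = v := by
  obtain ⟨X, hX⟩ := exists_eventuallyEq_extend x v
  exact ⟨X, by rw [hX.self_of_nhds, FiberBundle.extend_apply_self]⟩

/-- The 1-forms dual to the local frame at `x`, multiplied by the bump function. -/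
def coordForm (x : M) (i : Fin (Module.finrank ℝ E)) :
    SmoothField E M →ₗ[SmoothFun E M] SmoothFun E M where
  toFun X := ⟨fun y ↦ bump E x y • (trivializationAt E (TangentSpace 𝓘(ℝ, E) : M → Type _)
      x).localFrameCoeff 𝓘(ℝ, E) (Module.finBasis ℝ E) i y (X y),
    (bump E x).contMDiff_smul (contMDiffOn_baseSet_localFrameCoeff
      (e := trivializationAt E (TangentSpace 𝓘(ℝ, E) : M → Type _) x) (Module.finBasis ℝ E)
            X.contMDiff.contMDiffOn i)⟩
  map_add' X Y := by
    ext y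
    exact (congr(bump E x y * $(map_add _ (X y) (Y y)))).trans (mul_add _ _ _)
  map_smul' f X := by
    ext y
    exact (congr(bump E x y * $(map_smul _ (f y) (X y)))).trans (mul_left_comm _ _ _)

lemma coordForm_apply (x : M) (i : Fin (Module.finrank ℝ E)) (X : SmoothField E M) (y : M) :
    coordForm x i X y = bumpFun E x y * (trivializationAt E (TangentSpace 𝓘(ℝ, E) : M → Type _)
      x).localFrameCoeff 𝓘(ℝ, E) (Module.finBasis ℝ E) i y (X y) := rfl

/-- The local frame at `x` given by the trivialization of the tangent bundle, made global with a
bump function. This function enters both the fields and the forms, so that the cut-off function is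
its square. -/
def localFrame (x : M) : LocalFrameData (SmoothFun E M) (SmoothField E M)
    (Fin (Module.finrank ℝ E)) where
  vec i := bumpSMul x ((trivializationAt E (TangentSpace 𝓘(ℝ, E) : M → Type _) x).localFrame
    (Module.finBasis ℝ E) i) (Trivialization.contMDiffOn_localFrame_baseSet ∞ _ _ i)
  form := coordForm x
  cutoff := bumpFun E x * bumpFun E x
  sum_form_smul_vec X := by
    ext y
    have key (i) : (coordForm x i X • bumpSMul x ((trivializationAt E
        (TangentSpace 𝓘(ℝ, E) : M → Type _) x).localFrame (Module.finBasis ℝ E) i)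
          (Trivialization.contMDiffOn_localFrame_baseSet ∞ _ _ i)) y =
        (bumpFun E x * bumpFun E x) y • ((trivializationAt E (TangentSpace 𝓘(ℝ, E) : M → Type _)
          x).localFrameCoeff 𝓘(ℝ, E) (Module.finBasis ℝ E) i y (X y) • (trivializationAt E
        (TangentSpace 𝓘(ℝ, E) : M → Type _) x).localFrame (Module.finBasis ℝ E) i y) := by
      simp only [smul_apply, bumpSMul_apply, coordForm_apply, smul_smul, ContMDiffMap.coe_mul,
        Pi.mul_apply]
      congr 1
      ring
    rw [sum_apply, smul_apply, Finset.sum_congr rfl fun i _ ↦ key i, ← Finset.smul_sum]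
    by_cases hy : y ∈ (trivializationAt E (TangentSpace 𝓘(ℝ, E) : M → Type _) x).baseSet
    · rw [← Trivialization.eq_sum_localFrameCoeff_smul hy]
    · have : bumpFun E x y = 0 := image_eq_zero_of_notMem_tsupport fun h ↦ hy (tsupport_bump E x h)
      simp [this]

lemma localFrame_cutoff (x : M) : (localFrame (E := E) x).cutoff x = 1 := by
  have : bumpFun E x x = 1 := (bumpFun_eventuallyEq E x).self_of_nhds
  simp [localFrame, this]

end SmoothField

namespace PseudoRiemannianMetric

variable (g : PseudoRiemannianMetric E M)

omit [FiniteDimensional ℝ E] [T2Space M] in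
lemma contMDiffAt_pair {X Y : Π x : M, TangentSpace 𝓘(ℝ, E) x} {x : M}
    (hX : CMDiffAt ∞ (T% X) x) (hY : CMDiffAt ∞ (T% Y) x) :
    CMDiffAt ∞ (g.pair X Y) x := by
  have h := ContMDiffAt.clm_bundle_apply₂ (F₁ := E) (F₂ := E) (F₃ := ℝ)
    (E₁ := fun y : M ↦ TangentSpace 𝓘(ℝ, E) y) (E₂ := fun y : M ↦ TangentSpace 𝓘(ℝ, E) y)
    (E₃ := Bundle.Trivial M ℝ) (g.contMDiff x) hX hY
  rw [contMDiffAt_section] at h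
  simpa using! h

omit [FiniteDimensional ℝ E] [T2Space M] in
/-- The Gram matrix of a nondegenerate form in a basis is invertible. -/
lemma det_gram_ne_zero {ι : Type*} [Fintype ι] [DecidableEq ι] {x : M}
    (b : Module.Basis ι ℝ (TangentSpace 𝓘(ℝ, E) x)) :
    (Matrix.of fun i j ↦ g.inner x (b j) (b i)).det ≠ 0 := by
  intro h
  obtain ⟨v, hv, hGv⟩ := Matrix.exists_mulVec_eq_zero_iff.2 h
  have h0 : ∑ j, v j • b j = 0 := by
    refine g.nondegenerate x _ fun w ↦ ?_
    rw [← b.sum_repr w, map_sum]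
    refine Finset.sum_eq_zero fun i _ ↦ ?_
    have := congr_fun hGv i
    simp only [Matrix.mulVec, dotProduct, Matrix.of_apply, Pi.zero_apply] at this
    simp only [map_smul, map_sum, _root_.sum_apply, _root_.smul_apply,
      smul_eq_mul]
    rw [Finset.sum_congr rfl fun j _ ↦ mul_comm (v j) _, this, mul_zero]
  exact hv (funext fun j ↦ Fintype.linearIndependent_iff.1 b.linearIndependent v h0 j)

/-- A vector field is smooth if its scalar products with all smooth fields are smooth. In a local
frame, its coefficients solve a linear system with the Gram matrix, by Cramer's rule. -/
lemma contMDiff_of_pair {Y : Π x : M, TangentSpace 𝓘(ℝ, E) x}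
    (h : ∀ Z : SmoothField E M, CMDiff ∞ (g.pair Y Z)) : CMDiff ∞ (T% Y) := by
  intro x
  set t := trivializationAt E (TangentSpace 𝓘(ℝ, E) : M → Type _) x
  let b := Module.finBasis ℝ E
  have hx : x ∈ t.baseSet := FiberBundle.mem_baseSet_trivializationAt' x
  let s := t.localFrame b
  let G : M → Matrix (Fin (Module.finrank ℝ E)) (Fin (Module.finrank ℝ E)) ℝ :=
    fun y ↦ Matrix.of fun i j ↦ g.inner y (s j y) (s i y)
  have hs (i) : CMDiffAt ∞ (T% (s i)) x := contMDiffAt_localFrame_of_mem ∞ t b i hx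
  have hG (i j) : CMDiffAt ∞ (fun y ↦ G y i j) x := g.contMDiffAt_pair (hs j) (hs i)
  have hp (i) : CMDiffAt ∞ (g.pair Y (s i)) x := by
    have hsi := Trivialization.contMDiffOn_localFrame_baseSet (I := 𝓘(ℝ, E)) ∞ t b i
    refine (h (SmoothField.bumpSMul x (s i) hsi) x).congr_of_eventuallyEq ?_
    filter_upwards [SmoothField.bumpSMul_eventuallyEq x (s i) hsi] with y hy
    simp [pair, hy]
  have hdet (H : M → Matrix (Fin (Module.finrank ℝ E)) (Fin (Module.finrank ℝ E)) ℝ)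
      (hH : ∀ i j, CMDiffAt ∞ (fun y ↦ H y i j) x) : CMDiffAt ∞ (fun y ↦ (H y).det) x := by
    simp only [Matrix.det_apply']
    exact contMDiffAt_finsetSum fun σ _ ↦
      contMDiffAt_const.mul (contMDiffAt_finsetProd fun i _ ↦ hH _ _)
  have hcr (i) : CMDiffAt ∞ (fun y ↦ ((G y).cramer (fun j ↦ g.pair Y (s j) y)) i) x := by
    simp only [Matrix.cramer_apply]
    refine hdet _ fun j k ↦ ?_
    simp only [Matrix.updateCol_apply]
    split_ifs
    exacts [hp j, hG j k]
  have hdet0 (y) (hy : y ∈ t.baseSet) : (G y).det ≠ 0 := by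
    have := g.det_gram_ne_zero (t.basisAt b hy)
    convert this using 4
    simp [s, hy]
  rw [contMDiffAt_iff_localFrameCoeff (e := t) b hx]
  intro i
  refine ((hcr i).div₀ (hdet G hG) (hdet0 x hx)).congr_of_eventuallyEq ?_
  filter_upwards [t.open_baseSet.mem_nhds hx] with y hy
  change _ = (G y).cramer (fun j ↦ g.pair Y (s j) y) i / (G y).det
  rw [eq_div_iff (hdet0 y hy)]
  set c := fun i ↦ t.localFrameCoeff 𝓘(ℝ, E) b i y (Y y) with hc
  have hY : (fun j ↦ g.pair Y (s j) y) = (G y).mulVec c := by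
    ext j
    have h1 : Y y = ∑ i, c i • s i y := Trivialization.eq_sum_localFrameCoeff_smul hy
    simp only [pair, h1, map_sum, map_smul, Matrix.mulVec, dotProduct, G, Matrix.of_apply]
    simp [mul_comm]
  rw [hY, Matrix.cramer_eq_adjugate_mulVec, Matrix.mulVec_mulVec, Matrix.adjugate_mul,
    Matrix.smul_mulVec, Matrix.one_mulVec]
  exact mul_comm _ _

end PseudoRiemannianMetric

end Frames

/-! ### Tensoriality and traces at a point -/

section Calculus

variable {E : Type*} [NormedAddCommGroup E] [NormedSpace ℝ E] [FiniteDimensional ℝ E]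
  {M : Type*} [TopologicalSpace M] [ChartedSpace E M] [IsManifold 𝓘(ℝ, E) ∞ M] [T2Space M]

namespace SmoothField

variable {x : M}

lemma apply_eq_sum (T : SmoothField E M →ₗ[SmoothFun E M] SmoothField E M)
    (X : SmoothField E M) (x : M) :
    T X x = ∑ i, coordForm x i X x • T ((localFrame x).vec i) x := by
  have h := congr(T $((localFrame x).sum_form_smul_vec X) x)
  rw [map_smul, smul_apply, localFrame_cutoff, one_smul, map_sum, sum_apply] at h
  rw [← h]
  exact Finset.sum_congr rfl fun i _ ↦ by rw [map_smul, smul_apply]; rfl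

lemma map_eq_of_eq (T : SmoothField E M →ₗ[SmoothFun E M] SmoothField E M)
    {X Y : SmoothField E M} (h : X x = Y x) : T X x = T Y x := by
  rw [apply_eq_sum T X, apply_eq_sum T Y]
  exact Finset.sum_congr rfl fun i _ ↦ by rw [coordForm_apply, coordForm_apply, h]

/-- The endomorphism of the tangent space at `x` induced by an endomorphism of the module of smooth
fields. -/
def evalAt (x : M) (T : SmoothField E M →ₗ[SmoothFun E M] SmoothField E M) :
    TangentSpace 𝓘(ℝ, E) x →ₗ[ℝ] TangentSpace 𝓘(ℝ, E) x :=
  ∑ i, ((trivializationAt E (TangentSpace 𝓘(ℝ, E) : M → Type _)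
      x).localFrameCoeff 𝓘(ℝ, E) (Module.finBasis ℝ E) i x).smulRight (T ((localFrame x).vec i) x)

lemma coordForm_apply_self (i : Fin (Module.finrank ℝ E)) (X : SmoothField E M) :
    coordForm x i X x = (trivializationAt E (TangentSpace 𝓘(ℝ, E) : M → Type _)
      x).localFrameCoeff 𝓘(ℝ, E) (Module.finBasis ℝ E) i x (X x) := by
  rw [coordForm_apply, (bumpFun_eventuallyEq E x).self_of_nhds, one_mul]

lemma evalAt_apply (T : SmoothField E M →ₗ[SmoothFun E M] SmoothField E M) (X : SmoothField E M) :
    evalAt x T (X x) = T X x := by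
  rw [apply_eq_sum T X, evalAt, LinearMap.sum_apply]
  exact Finset.sum_congr rfl fun i _ ↦ by rw [LinearMap.smulRight_apply, coordForm_apply_self]

lemma evalAt_zero (x : M) : evalAt x
    (0 : SmoothField E M →ₗ[SmoothFun E M] SmoothField E M) = 0 := by
  ext v
  obtain ⟨X, rfl⟩ := exists_apply_eq x v
  rw [evalAt_apply]; rfl

lemma trace_evalAt (T : SmoothField E M →ₗ[SmoothFun E M] SmoothField E M) :
    LinearMap.trace ℝ _ (evalAt x T) = (localFrame x).trace T x := by
  have : FiniteDimensional ℝ (TangentSpace 𝓘(ℝ, E) x) := inferInstanceAs (FiniteDimensional ℝ E)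
  rw [evalAt, map_sum, LocalFrameData.trace]
  have (s : Finset (Fin (Module.finrank ℝ E))) (f : Fin (Module.finrank ℝ E) → SmoothFun E M) :
      (∑ i ∈ s, f i) x = ∑ i ∈ s, f i x := by
    rw [← ContMDiffMap.coeFnRingHom_apply, map_sum, Finset.sum_apply]; rfl
  rw [this]
  refine Finset.sum_congr rfl fun i _ ↦ ?_
  rw [LinearMap.trace_smulRight]
  exact (coordForm_apply_self i _).symm

/-- The bracket acts on functions as a commutator. This is the coefficient of `Z` in the Jacobi
identity for `X`, `Y`, `f • Z`. -/
lemma derivation_bracket [Nontrivial E] (X Y : SmoothField E M) (f : SmoothFun E M) :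
    (X.bracket Y).derivation f = X.derivation (Y.derivation f) - Y.derivation (X.derivation f) := by
  have key (Z : SmoothField E M) : (X.derivation (Y.derivation f) - Y.derivation (X.derivation f) -
      (X.bracket Y).derivation f) • Z = 0 := by
    have h1 := bracket_jacobi X Y (f • Z)
    have h2 := bracket_jacobi X Y Z
    simp only [bracket_smul, bracket_add, h2] at h1
    rw [← sub_eq_zero] at h1
    rw [← h1]
    module
  ext x
  obtain ⟨v, hv⟩ := exists_ne (0 : E)
  obtain ⟨Z, hZ⟩ := exists_apply_eq x (v : TangentSpace 𝓘(ℝ, E) x)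
  have h := congr($(key Z) x)
  rw [smul_apply, zero_apply, hZ] at h
  have h3 := (smul_eq_zero.1 h).resolve_right hv
  have h4 : X.derivation (Y.derivation f) x - Y.derivation (X.derivation f) x -
      (X.bracket Y).derivation f x = 0 := h3
  change (X.bracket Y).derivation f x =
    X.derivation (Y.derivation f) x - Y.derivation (X.derivation f) x
  linarith

end SmoothField

namespace PseudoRiemannianMetric

variable (g : PseudoRiemannianMetric E M)

/-- The smooth function `g(X, Y)`. -/
def pairFun (X Y : SmoothField E M) : SmoothFun E M :=
  ⟨g.pair X Y, fun x ↦ g.contMDiffAt_pair (X.contMDiff x) (Y.contMDiff x)⟩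

omit [FiniteDimensional ℝ E] [T2Space M] in
lemma pairFun_apply (X Y : SmoothField E M) (x : M) :
    g.pairFun X Y x = g.inner x (X x) (Y x) := rfl

/-- The smooth vector field `∇_X Y`. -/
def nablaField (X Y : SmoothField E M) : SmoothField E M :=
  ⟨g.nabla X Y, g.contMDiff_of_pair fun Z ↦ by
    have h : g.pair (g.nabla X Y) Z = ⇑((1 / 2 : ℝ) • (X.derivation (g.pairFun Y Z) +
        Y.derivation (g.pairFun Z X) - Z.derivation (g.pairFun X Y) +
        g.pairFun (X.bracket Y) Z - g.pairFun (Y.bracket Z) X + g.pairFun (Z.bracket X) Y)) := by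
      ext x
      exact inner_leviCivitaFun (X.mdiffAt x) (Y.mdiffAt x) (Z.mdiffAt x)
    rw [h]
    exact ContMDiffMap.contMDiff _⟩

lemma nablaField_apply (X Y : SmoothField E M) (x : M) :
    g.nablaField X Y x = g.leviCivita Y x (X x) := rfl

lemma nablaField_sub_swap (X Y : SmoothField E M) :
    g.nablaField X Y - g.nablaField Y X = X.bracket Y := by
  ext x
  exact leviCivita_torsion (X.mdiffAt x) (Y.mdiffAt x)

/-- The Levi-Civita connection on the module of smooth vector fields. -/
def connection [Nontrivial E] : TorsionFreeConnection (SmoothFun E M) (SmoothField E M) where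
  D :=
    { toFun := SmoothField.derivation
      map_add' X Y := by
        ext f x
        exact map_add (mvfderiv 𝓘(ℝ, E) f x) (X x) (Y x)
      map_smul' h X := by
        ext f x
        exact map_smul (mvfderiv 𝓘(ℝ, E) f x) (h x) (X x) }
  nab :=
    { toFun := fun X ↦ AddMonoidHom.mk' (g.nablaField X) fun Y Z ↦ by
        ext x
        exact congr($(g.leviCivita.isCovariantDerivativeOnUniv.add (Y.mdiffAt x) (Z.mdiffAt x))
          (X x))
      map_add' X Y := by
        ext Z x
        exact map_add (g.leviCivita Z x) (X x) (Y x)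
      map_smul' h X := by
        ext Z x
        exact map_smul (g.leviCivita Z x) (h x) (X x) }
  nab_smul X f Y := by
    ext x
    exact congr($(g.leviCivita.isCovariantDerivativeOnUniv.leibniz (Y.mdiffAt x)
      (f.mdifferentiableAt (x := x))) (X x))
  D_lie X Y f := by
    change (g.nablaField X Y - g.nablaField Y X).derivation f = _
    rw [nablaField_sub_swap, SmoothField.derivation_bracket]
    rfl
  jacobi X Y Z := by
    have h := SmoothField.bracket_jacobi X Y Z
    simp only [← g.nablaField_sub_swap] at h
    exact h

variable [Nontrivial E]

lemma connection_lie (X Y : SmoothField E M) : g.connection.lie X Y = X.bracket Y :=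
  g.nablaField_sub_swap X Y

omit [Nontrivial E] in
lemma nabla_congr {X Y : Π x : M, TangentSpace 𝓘(ℝ, E) x} {X' Y' : SmoothField E M} {x : M}
    (hX : ∀ᶠ y in 𝓝 x, X' y = X y) (hY : ∀ᶠ y in 𝓝 x, Y' y = Y y) :
    ∀ᶠ y in 𝓝 x, g.nablaField X' Y' y = g.nabla X Y y := by
  filter_upwards [hX, hY.eventually_nhds] with y hXy hYy
  have hd : MDiffAt (T% Y) y := (Y'.mdiffAt y).congr_of_eventuallyEq <| by
    filter_upwards [hYy] with z hz
    rw [hz]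
  rw [nablaField_apply, nabla, hXy,
    g.leviCivita.isCovariantDerivativeOnUniv.congr_of_eventuallyEq (Y'.mdiffAt y) hd
      Filter.univ_mem hYy]

lemma curvature_congr {X Y Z : Π x : M, TangentSpace 𝓘(ℝ, E) x} {X' Y' Z' : SmoothField E M}
    {x : M} (hX : ∀ᶠ y in 𝓝 x, X' y = X y) (hY : ∀ᶠ y in 𝓝 x, Y' y = Y y)
    (hZ : ∀ᶠ y in 𝓝 x, Z' y = Z y) :
    g.curvature X Y Z x = g.connection.curv X' Y' Z' x := by
  have hXY : ∀ᶠ y in 𝓝 x, X'.bracket Y' y = VectorField.mlieBracket 𝓘(ℝ, E) X Y y :=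
    Filter.EventuallyEq.mlieBracket_vectorField hX hY
  have h1 := (g.nabla_congr hX (g.nabla_congr hY hZ)).self_of_nhds
  have h2 := (g.nabla_congr hY (g.nabla_congr hX hZ)).self_of_nhds
  have h3 := (g.nabla_congr hXY hZ).self_of_nhds
  rw [TorsionFreeConnection.curv, connection_lie]
  change g.nabla X (g.nabla Y Z) x - g.nabla Y (g.nabla X Z) x - g.nabla _ Z x = _
  rw [← h1, ← h2, ← h3]
  rfl

lemma curv_eq_of_eq {X Y Z Y' Z' : SmoothField E M} {x : M} (hY : Y x = Y' x) (hZ : Z x = Z' x) :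
    g.connection.curv X Y Z x = g.connection.curv X Y' Z' x := by
  let T₁ : SmoothField E M →ₗ[SmoothFun E M] SmoothField E M :=
    { toFun := fun Y ↦ g.connection.curv X Y Z
      map_add' := fun _ _ ↦ TorsionFreeConnection.curv_add_middle ..
      map_smul' := fun _ _ ↦ TorsionFreeConnection.curv_smul_middle .. }
  let T₂ : SmoothField E M →ₗ[SmoothFun E M] SmoothField E M :=
    { toFun := fun Z ↦ g.connection.curv X Y' Z
      map_add' := fun _ _ ↦ TorsionFreeConnection.curv_add_right ..
      map_smul' := fun _ _ ↦ TorsionFreeConnection.curv_smul_right .. }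
  exact (SmoothField.map_eq_of_eq T₁ hY).trans (SmoothField.map_eq_of_eq T₂ hZ)

lemma ricci_eq_trace (Y Z : SmoothField E M) (x : M) :
    g.ricci x (Y x) (Z x) =
      LinearMap.trace ℝ _ (SmoothField.evalAt x (g.connection.curvEnd Y Z)) := by
  let b : Module.Basis (Fin (Module.finrank ℝ E)) ℝ (TangentSpace 𝓘(ℝ, E) x) :=
    Module.finBasis ℝ E
  rw [LinearMap.trace_eq_matrix_trace ℝ b, Matrix.trace]
  change ∑ i, b.repr (g.curvature (FiberBundle.extend E (b i)) (FiberBundle.extend E (Y x))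
    (FiberBundle.extend E (Z x)) x) i = _
  refine Finset.sum_congr rfl fun i _ ↦ ?_
  obtain ⟨X', hX'⟩ := SmoothField.exists_eventuallyEq_extend x (b i)
  obtain ⟨Y', hY'⟩ := SmoothField.exists_eventuallyEq_extend x (Y x)
  obtain ⟨Z', hZ'⟩ := SmoothField.exists_eventuallyEq_extend x (Z x)
  have hX : X' x = b i := by rw [hX'.self_of_nhds, FiberBundle.extend_apply_self]
  have hY : Y' x = Y x := by rw [hY'.self_of_nhds, FiberBundle.extend_apply_self]
  have hZ : Z' x = Z x := by rw [hZ'.self_of_nhds, FiberBundle.extend_apply_self]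
  rw [g.curvature_congr hX' hY' hZ', g.curv_eq_of_eq hY hZ, Matrix.diag_apply,
    LinearMap.toMatrix_apply, ← hX, SmoothField.evalAt_apply]
  rfl

end PseudoRiemannianMetric

end Calculus

/-! ### Kenmotsu manifolds -/

namespace AlmostContactPseudoMetric

section

variable {E : Type*} [NormedAddCommGroup E] [NormedSpace ℝ E] [FiniteDimensional ℝ E]
  {M : Type*} [TopologicalSpace M] [ChartedSpace E M] [IsManifold 𝓘(ℝ, E) ∞ M] [T2Space M]
  (S : AlmostContactPseudoMetric E M)

/-- The Reeb field as a smooth field. -/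
def ξField : SmoothField E M := ⟨S.ξ, S.contMDiff_ξ⟩

/-- The smooth field `φ X`. -/
def φField (X : SmoothField E M) : SmoothField E M :=
  ⟨fun x ↦ S.φ x (X x), ContMDiff.clm_bundle_apply (F₁ := E) (F₂ := E)
    (E₁ := fun y : M ↦ TangentSpace 𝓘(ℝ, E) y) (E₂ := fun y : M ↦ TangentSpace 𝓘(ℝ, E) y)
    S.contMDiff_φ X.contMDiff⟩

/-- The smooth function `η X`. -/
def ηFun (X : SmoothField E M) : SmoothFun E M :=
  ⟨fun x ↦ S.η x (X x), fun x ↦ by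
    have h := ContMDiffAt.clm_bundle_apply (F₁ := E) (F₂ := ℝ)
      (E₁ := fun y : M ↦ TangentSpace 𝓘(ℝ, E) y) (E₂ := Bundle.Trivial M ℝ)
      (S.contMDiff_η x) (X.contMDiff x)
    rw [contMDiffAt_section] at h
    simpa using! h⟩

omit [FiniteDimensional ℝ E] [T2Space M] in
lemma inner_ξ_ξ (x : M) : S.g.inner x (S.ξ x) (S.ξ x) = S.ε := by
  have h := S.inner_φ_φ x (S.ξ x) (S.ξ x)
  rw [S.φ_ξ, S.η_ξ, map_zero] at h
  simp only [mul_one] at h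
  linarith

omit [T2Space M] in
lemma lieDerivative_eq (V X Y : SmoothField E M) (x : M) :
    S.g.lieDerivative V X Y x = S.g.inner x (S.g.leviCivita V x (X x)) (Y x) +
      S.g.inner x (X x) (S.g.leviCivita V x (Y x)) := by
  rw [PseudoRiemannianMetric.lieDerivative,
    PseudoRiemannianMetric.leviCivita_metric (X.mdiffAt x) (Y.mdiffAt x),
    ← PseudoRiemannianMetric.leviCivita_torsion (g := S.g) (V.mdiffAt x) (X.mdiffAt x),
    ← PseudoRiemannianMetric.leviCivita_torsion (g := S.g) (V.mdiffAt x) (Y.mdiffAt x)]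
  simp only [map_sub, _root_.sub_apply]
  ring

omit [FiniteDimensional ℝ E] [IsManifold 𝓘(ℝ, E) ∞ M] [T2Space M] in
lemma exists_notMem_span {x : M} {s : Finset (TangentSpace 𝓘(ℝ, E) x)}
    (hs : s.card < Module.finrank ℝ E) :
    ∃ u, u ∉ Submodule.span ℝ (s : Set (TangentSpace 𝓘(ℝ, E) x)) := by
  by_contra! h
  have h1 : Submodule.span ℝ (s : Set (TangentSpace 𝓘(ℝ, E) x)) = ⊤ := by
    rw [eq_top_iff]; exact fun u _ ↦ h u
  have h2 := finrank_span_finset_le_card (R := ℝ) s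
  rw [Set.finrank, h1, finrank_top] at h2
  exact absurd h2 (not_le.2 hs)

variable [Nontrivial E]

variable {S} in
/-- The module of smooth vector fields of a Kenmotsu pseudo-metric manifold. -/
def calculus (hK : S.IsKenmotsu) : KenmotsuCalculus (SmoothFun E M) (SmoothField E M) where
  toTorsionFreeConnection := S.g.connection
  g := LinearMap.mk₂ _ S.g.pairFun
    (fun X Y Z ↦ by ext x; simp [PseudoRiemannianMetric.pairFun_apply])
    (fun f X Y ↦ by ext x; simp [PseudoRiemannianMetric.pairFun_apply])
    (fun X Y Z ↦ by ext x; simp [PseudoRiemannianMetric.pairFun_apply])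
    (fun f X Y ↦ by ext x; simp [PseudoRiemannianMetric.pairFun_apply])
  g_symm X Y := by ext x; exact S.g.symm x _ _
  g_nondeg X h := by
    ext x
    refine S.g.nondegenerate x _ fun v ↦ ?_
    obtain ⟨Y, rfl⟩ := SmoothField.exists_apply_eq x v
    exact congr($(h Y) x)
  D_g X Y Z := by
    ext x
    exact PseudoRiemannianMetric.leviCivita_metric (Y.mdiffAt x) (Z.mdiffAt x) (X x)
  φ :=
    { toFun := S.φField
      map_add' X Y := by ext x; exact map_add (S.φ x) _ _
      map_smul' f X := by ext x; exact map_smul (S.φ x) _ _ }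
  ξ := S.ξField
  η :=
    { toFun := S.ηFun
      map_add' X Y := by ext x; exact map_add (S.η x) _ _
      map_smul' f X := by ext x; exact map_smul (S.η x) _ _ }
  e := algebraMap ℝ _ S.ε
  e_mul_e := by
    rw [← map_mul]
    rcases S.ε_eq with h | h <;> simp [h]
  D_e X := Derivation.map_algebraMap _ _
  φ_φ X := by ext x; exact S.φ_φ x _
  η_ξ := by ext x; exact S.η_ξ x
  φ_ξ := by ext x; exact S.φ_ξ x
  η_φ X := by ext x; exact S.η_φ x _
  g_φ_φ X Y := by ext x; exact S.inner_φ_φ x _ _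
  nab_φ X Y := by ext x; exact hK x X Y (X.mdiffAt x) (Y.mdiffAt x)

variable {S} (hK : S.IsKenmotsu) {x : M}

lemma calculus_hor_apply (X : SmoothField E M) :
    (calculus hK).hor X x = X x - S.η x (X x) • S.ξ x := rfl

/-- The Ricci tensor of the Weyl connection is `Ric + 2n ε g`, where `2n + 1` is the dimension: this
is the trace of `KenmotsuCalculus.curv_eq`. -/
lemma trace_weyl_curvEnd (Y Z : SmoothField E M) (x : M) :
    LinearMap.trace ℝ _ (SmoothField.evalAt x ((calculus hK).weyl.curvEnd Y Z)) =
      S.g.ricci x (Y x) (Z x) +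
        S.ε * (Module.finrank ℝ E - 1) * S.g.inner x (Y x) (Z x) := by
  have : FiniteDimensional ℝ (TangentSpace 𝓘(ℝ, E) x) := inferInstanceAs (FiniteDimensional ℝ E)
  have h : SmoothField.evalAt x (S.g.connection.curvEnd Y Z) =
      SmoothField.evalAt x ((calculus hK).weyl.curvEnd Y Z) -
        S.ε • (S.g.inner x (Y x) (Z x) • LinearMap.id -
          ((S.g.inner x (Z x)).toLinearMap).smulRight (Y x)) := by
    ext v
    obtain ⟨X, rfl⟩ := SmoothField.exists_apply_eq x v
    have h1 := congr($((calculus hK).curv_eq X Y Z) x)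
    simp only [LinearMap.sub_apply, LinearMap.smul_apply, SmoothField.evalAt_apply,
      LinearMap.id_apply, LinearMap.smulRight_apply]
    refine Eq.trans h1 ?_
    rw [ContinuousLinearMap.coe_coe, S.g.symm x (Z x)]
    rfl
  rw [S.g.ricci_eq_trace, h]
  simp only [map_sub, map_smul, LinearMap.trace_id, LinearMap.trace_smulRight, smul_eq_mul]
  rw [ContinuousLinearMap.coe_coe, S.g.symm x (Z x),
    show Module.finrank ℝ (TangentSpace 𝓘(ℝ, E) x) = Module.finrank ℝ E from rfl]
  ring

lemma exists_hor_ne_zero (hdim : 1 < Module.finrank ℝ E) (x : M) :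
    ∃ X : SmoothField E M, (calculus hK).η X = 0 ∧ X x ≠ 0 := by
  obtain ⟨u, hu⟩ := exists_notMem_span (s := {S.ξ x}) (by simpa using hdim)
  obtain ⟨X, rfl⟩ := SmoothField.exists_apply_eq x u
  refine ⟨(calculus hK).hor X, (calculus hK).η_hor X, fun h ↦ hu ?_⟩
  rw [calculus_hor_apply, sub_eq_zero] at h
  rw [h]
  exact Submodule.smul_mem _ _ (Submodule.subset_span (by simp))

/-- On a soliton, `b` is constant in the horizontal directions. The vector `W` is chosen outside the
`φ`-invariant plane spanned by `X` and `φX`; this needs dimension greater than three. -/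
lemma D_eq_zero_of_soliton (hdim : 3 < Module.finrank ℝ E) {V : SmoothField E M}
    {B c : SmoothFun E M} (h : (calculus hK).IsSoliton V B c) (X : SmoothField E M)
    (hX : (calculus hK).η X = 0) : (calculus hK).D X B = 0 := by
  ext x
  classical
  obtain ⟨u, hu⟩ := exists_notMem_span (x := x) (s := {S.ξ x, X x, S.φ x (X x)})
    (lt_of_le_of_lt Finset.card_le_three hdim)
  obtain ⟨Y, rfl⟩ := SmoothField.exists_apply_eq x u
  by_contra hp
  have hp' : (calculus hK).D X B x ≠ 0 := hp
  refine hu ?_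
  set T := Submodule.span ℝ
    (({S.ξ x, X x, S.φ x (X x)} : Finset (TangentSpace 𝓘(ℝ, E) x)) : Set (TangentSpace 𝓘(ℝ, E) x))
  have hξT : S.ξ x ∈ T := Submodule.subset_span (by simp)
  have hXT : X x ∈ T := Submodule.subset_span (by simp)
  have hφT : S.φ x (X x) ∈ T := Submodule.subset_span (by simp)
  -- With `W` the horizontal part of `Y`, the relation `p W - r X = q φW - s φX` and its image under
  -- `φ` give `(p² + q²) W ∈ T`, hence `Y x ∈ T`.
  set W := (calculus hK).hor Y
  have hW : (calculus hK).η W = 0 := (calculus hK).η_hor Y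
  have hWx : S.η x (W x) = 0 := congr($hW x)
  have hXx : S.η x (X x) = 0 := congr($hX x)
  set p := (calculus hK).D X B x
  set q := (calculus hK).D ((calculus hK).φ X) B x
  set r := (calculus hK).D W B x
  set s := (calculus hK).D ((calculus hK).φ W) B x
  have h1 : p • W x - r • X x = q • S.φ x (W x) - s • S.φ x (X x) :=
    congr($(h.D_smul_sub hX hW) x)
  have h2 := congr(S.φ x $h1)
  simp only [map_sub, map_smul, S.φ_φ, hWx, hXx, zero_smul, add_zero] at h2
  have h3 : (p ^ 2 + q ^ 2) • W x = (p * r + q * s) • X x + (q * r - p * s) • S.φ x (X x) := by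
    linear_combination (norm := module) p • h1 + q • h2
  have h4 : W x ∈ T := by
    rw [← inv_smul_smul₀ (by positivity : p ^ 2 + q ^ 2 ≠ 0) (W x), h3]
    exact T.smul_mem _ (T.add_mem (T.smul_mem _ hXT) (T.smul_mem _ hφT))
  have h5 : Y x = W x + S.η x (Y x) • S.ξ x := by rw [calculus_hor_apply]; module
  rw [h5]
  exact T.add_mem h4 (T.smul_mem _ hξT)

variable {a b : M → ℝ} (hab : ∀ (x : M) (u v : TangentSpace 𝓘(ℝ, E) x),
    S.g.ricci x u v = a x * S.g.inner x u v + b x * S.η x u * S.η x v)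
include hK hab

/-- Evaluating the Ricci tensor at `(ξ, ξ)` gives `ε a + b = -2n`. -/
lemma coeff_eq (x : M) : a x = -S.ε * (Module.finrank ℝ E - 1 + b x) := by
  have h1 := trace_weyl_curvEnd hK S.ξField S.ξField x
  have h2 : (calculus hK).weyl.curvEnd S.ξField S.ξField = 0 := by
    ext1 X
    exact (calculus hK).weyl_curv_ξ X S.ξField
  rw [h2, SmoothField.evalAt_zero, map_zero, hab] at h1
  change 0 = a x * S.g.inner x (S.ξ x) (S.ξ x) + b x * S.η x (S.ξ x) * S.η x (S.ξ x) +
    S.ε * _ * S.g.inner x (S.ξ x) (S.ξ x) at h1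
  rw [inner_ξ_ξ, S.η_ξ] at h1
  have he : S.ε * S.ε = 1 := by rcases S.ε_eq with h | h <;> simp [h]
  linear_combination -S.ε * h1 + (-a x - S.ε * (Module.finrank ℝ E - 1)) * he

lemma trace_weyl_curvEnd_eq (Y Z : SmoothField E M) (x : M) :
    LinearMap.trace ℝ _ (SmoothField.evalAt x ((calculus hK).weyl.curvEnd Y Z)) =
      -(S.ε * b x * (S.g.inner x (Y x) (Z x) - S.ε * S.η x (Y x) * S.η x (Z x))) := by
  have he : S.ε * S.ε = 1 := by rcases S.ε_eq with h | h <;> simp [h]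
  rw [trace_weyl_curvEnd, hab, coeff_eq hK hab]
  linear_combination (-b x * S.η x (Y x) * S.η x (Z x)) * he

/-- In the `ξ`-direction `b` decays as `e^{-2t}`. -/
lemma D_ξ_coeff (hdim : 1 < Module.finrank ℝ E) (B : SmoothFun E M) (hB : ⇑B = b) :
    (calculus hK).D (calculus hK).ξ B = -2 * B := by
  ext x
  have hF (Y Z : SmoothField E M) :
      (SmoothField.localFrame x).trace ((calculus hK).weyl.curvEnd Y Z) =
      (SmoothField.localFrame x).cutoff * -((calculus hK).e * B * ((calculus hK).g Y Z -
        (calculus hK).e * (calculus hK).η Y * (calculus hK).η Z)) := by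
    ext y
    have h1 := congr($((SmoothField.localFrame x).cutoff_mul_trace (SmoothField.localFrame y)
      ((calculus hK).weyl.curvEnd Y Z)) y)
    rw [ContMDiffMap.coe_mul, ContMDiffMap.coe_mul, Pi.mul_apply, Pi.mul_apply,
      SmoothField.localFrame_cutoff, ← SmoothField.trace_evalAt, trace_weyl_curvEnd_eq hK hab,
      one_mul, ← hB] at h1
    exact h1
  obtain ⟨X, hX, hX0⟩ := exists_hor_ne_zero hK hdim x
  obtain ⟨v, hv⟩ : ∃ v, S.g.inner x (X x) v ≠ 0 := by
    by_contra! h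
    exact hX0 (S.g.nondegenerate x _ h)
  obtain ⟨Y, rfl⟩ := SmoothField.exists_apply_eq x v
  have h1 := (calculus hK).cutoff_mul_D_ξ_add (SmoothField.localFrame x) hF X Y
  rw [hX, mul_zero, zero_mul, sub_zero] at h1
  have h2 := congr($h1 x)
  have h3 : (SmoothField.localFrame (E := E) x).cutoff x *
      (SmoothField.localFrame (E := E) x).cutoff x *
      (((calculus hK).D (calculus hK).ξ B x + (2 : SmoothFun E M) x * B x) *
        S.g.inner x (X x) (Y x)) = 0 := h2
  rw [SmoothField.localFrame_cutoff, one_mul, one_mul, SmoothFun.two_apply] at h3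
  have h4 := (mul_eq_zero.1 h3).resolve_right hv
  change _ = -(2 : SmoothFun E M) x * B x
  rw [SmoothFun.two_apply]
  linarith

/-- If the curvature annihilates the gradient `U`, so does the Ricci tensor `-ε b (g - ε η ⊗ η)`,
hence `b U = 0`. -/
lemma smul_solitonGrad_eq_zero {B : SmoothFun E M} (hB : ⇑B = b) (V : SmoothField E M)
    (h0 : ∀ X Y, (calculus hK).weyl.curv X Y ((calculus hK).solitonGrad V) = 0) :
    B • (calculus hK).solitonGrad V = 0 := by
  refine (calculus hK).g_nondeg _ fun Y ↦ ?_
  ext x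
  have h1 := trace_weyl_curvEnd_eq hK hab Y ((calculus hK).solitonGrad V) x
  have h2 : (calculus hK).weyl.curvEnd Y ((calculus hK).solitonGrad V) = 0 := by
    ext1 X
    exact h0 X Y
  have h3 : S.η x ((calculus hK).solitonGrad V x) = 0 :=
    congr($((calculus hK).η_solitonGrad V) x)
  rw [h2, SmoothField.evalAt_zero, map_zero, h3, mul_zero, sub_zero] at h1
  have he : S.ε ≠ 0 := by rcases S.ε_eq with h | h <;> simp [h]
  have h4 : b x * S.g.inner x (Y x) ((calculus hK).solitonGrad V x) = 0 := by
    have : S.ε * (b x * S.g.inner x (Y x) ((calculus hK).solitonGrad V x)) = 0 := by linarith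
    exact (mul_eq_zero.1 this).resolve_left he
  rw [map_smul, LinearMap.smul_apply, smul_eq_mul, (calculus hK).g_symm, ContMDiffMap.coe_mul,
    Pi.mul_apply, hB]
  exact h4

end

variable {E : Type*} [NormedAddCommGroup E] [NormedSpace ℝ E] [FiniteDimensional ℝ E]
  [Nontrivial E] {M : Type*} [TopologicalSpace M] [ChartedSpace E M]
  [IsManifold 𝓘(ℝ, E) ∞ M] [T2Space M] {S : AlmostContactPseudoMetric E M}

/-- An `η`-Einstein Kenmotsu Ricci soliton of dimension `2n + 1 > 3` has `Ric = -2n ε g`. -/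
theorem ricci_eq_of_isRicciSoliton (hdim : 3 < Module.finrank ℝ E) (hK : S.IsKenmotsu)
    (hE : S.IsEtaEinstein) {V : Π x : M, TangentSpace 𝓘(ℝ, E) x} {lam : ℝ}
    (hV : S.g.IsRicciSoliton V lam) (x : M) (u v : TangentSpace 𝓘(ℝ, E) x) :
    S.g.ricci x u v = -(Module.finrank ℝ E - 1) * S.ε * S.g.inner x u v := by
  obtain ⟨a, b, -, hb, hab⟩ := hE
  let B : SmoothFun E M := ⟨b, hb⟩
  let V' : SmoothField E M := ⟨V, hV.contMDiff⟩
  let c : SmoothFun E M := algebraMap ℝ _ (S.ε * (Module.finrank ℝ E - 1) - lam)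
  have hD : (calculus hK).D (calculus hK).ξ B = -2 * B :=
    D_ξ_coeff hK hab (by lia) B rfl
  have hS : (calculus hK).IsSoliton V' B c :=
    { lie_g := fun X Y ↦ by
        ext y
        have h1 := hV.eq_zero y X Y (X.mdiffAt y) (Y.mdiffAt y)
        have h2 := lieDerivative_eq (S := S) V' X Y y
        change S.g.inner y (S.g.leviCivita V y (X y)) (Y y) +
            S.g.inner y (X y) (S.g.leviCivita V y (Y y)) =
          (2 : SmoothFun E M) y * (S.ε * (Module.finrank ℝ E - 1) - lam + S.ε * b y) *
            S.g.inner y (X y) (Y y) -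
          (2 : SmoothFun E M) y * b y * S.η y (X y) * S.η y (Y y)
        change S.g.lieDerivative V X Y y = S.g.inner y (S.g.leviCivita V y (X y)) (Y y) +
            S.g.inner y (X y) (S.g.leviCivita V y (Y y)) at h2
        rw [SmoothFun.two_apply, ← h2]
        rw [hab, coeff_eq hK hab] at h1
        linear_combination h1
      D_c := fun X ↦ Derivation.map_algebraMap _ _
      D_ξ_b := hD }
  have hDh := D_eq_zero_of_soliton hK hdim hS
  have hU := smul_solitonGrad_eq_zero hK hab (B := B) rfl V'
    (hS.weyl_curv_solitonGrad_eq_zero hDh)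
  have hz : B * (2 * B + (calculus hK).e * c) = 0 := by
    ext y
    obtain ⟨X, hX, hX0⟩ := exists_hor_ne_zero hK (by lia) y
    have h1 := congr($(hS.mul_smul_eq_zero hDh hU hX) y)
    rw [SmoothField.smul_apply, SmoothField.zero_apply] at h1
    exact (smul_eq_zero.1 h1).resolve_right hX0
  have h4 := hS.mul_self_eq_zero_of hz
  have hb0 : b x = 0 := by
    have h4' : B * B = 0 := by
      apply KenmotsuCalculus.eq_of_two_mul
      apply KenmotsuCalculus.eq_of_two_mul
      linear_combination h4
    have h5 : b x * b x = 0 := congr($h4' x)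
    exact mul_self_eq_zero.1 h5
  rw [hab, coeff_eq hK hab, hb0]
  ring

end AlmostContactPseudoMetric

end

theorem theorem6p6 {n : ℕ} (hn : 1 < n)
    {M : Type*} [TopologicalSpace M] [T2Space M] [SecondCountableTopology M]
    [ChartedSpace (EuclideanSpace ℝ (Fin (2 * n + 1))) M]
    [IsManifold 𝓘(ℝ, EuclideanSpace ℝ (Fin (2 * n + 1))) ∞ M]
    (S : AlmostContactPseudoMetric (EuclideanSpace ℝ (Fin (2 * n + 1))) M)
    (hK : S.IsKenmotsu) (hE : S.IsEtaEinstein)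
    (V : Π x : M, TangentSpace 𝓘(ℝ, EuclideanSpace ℝ (Fin (2 * n + 1))) x) (lam : ℝ)
    (hV : S.g.IsRicciSoliton V lam) :
    S.g.IsEinstein ∧
      ∀ (x : M) (u v : TangentSpace 𝓘(ℝ, EuclideanSpace ℝ (Fin (2 * n + 1))) x),
        S.g.ricci x u v = -2 * n * S.ε * S.g.inner x u v := by
  have hdim : 3 < Module.finrank ℝ (EuclideanSpace ℝ (Fin (2 * n + 1))) := by
    rw [finrank_euclideanSpace_fin]; lia
  have key : ∀ (x : M) (u v : TangentSpace 𝓘(ℝ, EuclideanSpace ℝ (Fin (2 * n + 1))) x),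
      S.g.ricci x u v = -2 * n * S.ε * S.g.inner x u v := fun x u v ↦ by
    rw [AlmostContactPseudoMetric.ricci_eq_of_isRicciSoliton hdim hK hE hV,
      finrank_euclideanSpace_fin]
    push_cast
    ring
  exact ⟨⟨-2 * n * S.ε, key⟩, key⟩
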